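/- Let $\rho(p,q)$, $(p,q)\in\mathbb R^d\times\mathbb R^d$, be the Heisenberg operators on $L^2(\mathbb R^d)$, $[\rho(p,q)f](x)=e^{2\pi i q\cdot x+\pi i p\cdot q}f(x+p)$. Let $\mu$ be the metaplectic representation of the real symplectic group $Sp(d)$ on $L^2(\mathbb R^d)$, that is, a map from $Sp(d)$ to the unitary operators with $\mu(S)\rho(w)\mu(S)^{-1}=\rho(Sw)$ for all $S\in Sp(d)$, $w\in\mathbb R^{2d}$, and $\mu(ST)=\pm\mu(S)\mu(T)$ for all $S,T\in Sp(d)$ (such a map is unique up to the sign of each $\mu(S)$). Regard $\mathbb U(d)$ as a subgroup of $Sp(d)$ through the identification $(p,q)\mapsto p+iq$ of $\mathbb R^{2d}$ with $\mathbb C^d$. Let $\mathfrak F^d$ be the Fock space of entire functions $F$ on $\mathbb C^d$ with $\int|F(z)|^2e^{-\pi|z|^2}\,dz<\infty$, let $\hat B:L^2(\mathbb R^d)\to\mathfrak F^d$, $[\hat Bf](z)=2^{d/4}\int f(x)e^{2\pi x\cdot z-\pi x\cdot x-\frac{\pi}{2}z\cdot z}\,dx$, be the Bargmann transform, and put $\nu(g)=\hat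 B\mu(g)\hat B^*$ for $g\in\mathbb U(d)$. For $k\in\mathbb N_0$ let $\mathfrak F^d_k\subset\mathfrak F^d$ be the span of the monomials of total degree $k$, and let $T_k:S^k(\mathbb C^d)\to\mathfrak F^d_k$ be the linear isomorphism from the $k$-th symmetric power with $T_k(e_{j_1}\odot\cdots\odot e_{j_k})=z_{j_1}\cdots z_{j_k}$, where $(e_j)$ is the canonical basis of $\mathbb C^d$. Then for every $g\in\mathbb U(d)$ there is a square root $\det(g)^{-1/2}$ of $\det(g)^{-1}$ (depending only on $\mu$ and $g$) such that, for every $k\in\mathbb N_0$, the operator $\nu(g)$ maps $\mathfrak F^d_k$ into itself and, with $\nu_k(g)=\nu(g)|_{\mathfrak F^d_k}$, the operator $\eta_k(g):=T_k^{-1}\nu_k(g)T_k$ on $S^k(\mathbb C^d)$ satisfies $$\eta_k(g)(v_1\odot v_2\odot\cdots\odot v_k)=\det(g)^{-1/2}\,(\overline g v_1)\odot(\overline g v_2)\odot\cdots\odot(\overline g v_k)\qquad\text{for all } v_1,\dots,v_k\in\mathbb C^d,$$ where $\overline g$ is the entrywise complex conjugate of $g$. -/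

import Mathlib

open MeasureTheory
open scoped FourierTransform SchwartzMap ENNReal ContDiff

theorem fourier_ae_eq_fourier_toLp {V : Type*} [NormedAddCommGroup V] [InnerProductSpace ℝ V]
    [FiniteDimensional ℝ V] [MeasurableSpace V] [BorelSpace V] {h : V → ℂ}
    (h1 : Integrable h) (h2 : MemLp h 2) :
    (𝓕 (h2.toLp h) : Lp ℂ 2 (volume : Measure V)) =ᵐ[volume] 𝓕 h := by
  have hc : Continuous (𝓕 h) :=
    VectorFourier.fourierIntegral_continuous Real.continuous_fourierChar
      (by exact continuous_inner) h1
  refine ae_eq_of_integral_contDiff_smul_eq ((Lp.memLp _).locallyIntegrable (by norm_num))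
    hc.locallyIntegrable ?_
  intro g hg hgs
  let g' : V → ℂ := fun x => (g x : ℂ)
  have hg's : HasCompactSupport g' := hgs.comp_left (g := fun r : ℝ => (r : ℂ)) (by simp)
  have hg'c : ContDiff ℝ ∞ g' := Complex.ofRealCLM.contDiff.comp hg
  let φ : 𝓢(V, ℂ) := hg's.toSchwartzMap hg'c
  have hφ : ∀ x, φ x = g' x := fun x => rfl
  have e1 : ∫ x, g x • (𝓕 (h2.toLp h) : Lp ℂ 2 (volume : Measure V)) x =
      ∫ x, φ x • (𝓕 (h2.toLp h) : Lp ℂ 2 (volume : Measure V)) x := by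
    simp [hφ, g']
  rw [e1, ← Lp.toTemperedDistribution_apply, ← Lp.fourier_toTemperedDistribution_eq,
    TemperedDistribution.fourier_apply, Lp.toTemperedDistribution_apply]
  have e2 : ∫ x, (𝓕 φ) x • (h2.toLp h) x = ∫ x, (𝓕 φ) x • h x := by
    refine integral_congr_ae ?_
    filter_upwards [h2.coeFn_toLp] with x hx
    rw [hx]
  rw [e2]
  have := VectorFourier.integral_fourierIntegral_smul_eq_flip (μ := volume) (ν := volume)
    (L := innerₗ V) (f := φ) (g := h) Real.continuous_fourierChar
    (by exact continuous_inner) φ.integrable h1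
  have e3 : (innerₗ V).flip = innerₗ V := by ext x y; simp
  rw [e3] at this
  refine Eq.trans ?_ (this.trans ?_)
  · rfl
  · simp [hφ, g']; rfl

theorem lintegral_fourier_sq {V : Type*} [NormedAddCommGroup V] [InnerProductSpace ℝ V]
    [FiniteDimensional ℝ V] [MeasurableSpace V] [BorelSpace V] {h : V → ℂ}
    (h1 : Integrable h) (h2 : MemLp h 2) :
    ∫⁻ w, ‖𝓕 h w‖ₑ ^ 2 = ∫⁻ x, ‖h x‖ₑ ^ 2 := by
  have key : eLpNorm (𝓕 h) 2 volume = eLpNorm h 2 volume := by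
    rw [← eLpNorm_congr_ae (fourier_ae_eq_fourier_toLp h1 h2), ← eLpNorm_congr_ae h2.coeFn_toLp,
      ← Lp.enorm_def, ← Lp.enorm_def]
    have := Lp.norm_fourier_eq (h2.toLp h)
    rw [← ofReal_norm, ← ofReal_norm, this]
  rw [eLpNorm_eq_lintegral_rpow_enorm_toReal (p := 2) (by norm_num) (by norm_num),
    eLpNorm_eq_lintegral_rpow_enorm_toReal (p := 2) (by norm_num) (by norm_num)] at key
  have := ENNReal.rpow_left_injective (x := 1 / (2 : ℝ≥0∞).toReal) (by norm_num) key
  simpa using this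

noncomputable section

/-- The configuration Hilbert space `L²(ℝ^d)`. -/
abbrev L2Config (d : ℕ) : Type :=
  Lp ℂ 2 (volume : Measure (EuclideanSpace ℝ (Fin d)))

/-- The measure `e^{-π|z|²} dz` on `ℂ^d`. -/
def fockMeasure (d : ℕ) : Measure (Fin d → ℂ) :=
  volume.withDensity fun z => ENNReal.ofReal (Real.exp (-Real.pi * ∑ j, ‖z j‖ ^ 2))

/-- The kernel `2^{d/4} exp(2π x·z - π x·x - (π/2) z·z)` of the Bargmann transform. -/
def bargmannKernel (d : ℕ) (z : Fin d → ℂ) (x : EuclideanSpace ℝ (Fin d)) : ℂ :=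
  ((2 ^ ((d : ℝ) / 4) : ℝ) : ℂ) *
    Complex.exp (2 * Real.pi * ∑ j, (x j : ℂ) * z j - Real.pi * ∑ j, (x j : ℂ) ^ 2
      - Real.pi / 2 * ∑ j, z j ^ 2)

/-- The function `z ↦ ∫ 2^{d/4} exp(2π x·z - π x·x - (π/2) z·z) f(x) dx`. -/
def bargmannFun (d : ℕ) (f : EuclideanSpace ℝ (Fin d) → ℂ) (z : Fin d → ℂ) : ℂ :=
  ∫ x, bargmannKernel d z x * f x

theorem continuous_bargmannKernel (d : ℕ) (z : Fin d → ℂ) : Continuous (bargmannKernel d z) := by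
  unfold bargmannKernel
  fun_prop

theorem memLp_gauss (d : ℕ) {b : ℝ} (hb : 0 < b) (w : EuclideanSpace ℝ (Fin d)) :
    MemLp (fun x : EuclideanSpace ℝ (Fin d) => Real.exp (-b * ‖x‖ ^ 2 + inner ℝ w x)) 2 volume := by
  rw [memLp_two_iff_integrable_sq_norm (by fun_prop)]
  have := (GaussianFourier.integrable_cexp_neg_mul_sq_norm_add (b := (2 * b : ℝ))
    (V := EuclideanSpace ℝ (Fin d)) (by simpa using hb) 2 w).norm
  refine this.congr (ae_of_all _ fun x => ?_)
  simp only [Complex.norm_exp, Real.norm_eq_abs, Real.abs_exp, ← Real.exp_nat_mul]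
  congr 1
  have : (-((2 * b : ℝ) : ℂ) * (‖x‖ : ℂ) ^ 2 + 2 * ((inner ℝ w x : ℝ) : ℂ)) =
    ((-(2 * b) * ‖x‖ ^ 2 + 2 * inner ℝ w x : ℝ) : ℂ) := by push_cast; ring
  rw [this, Complex.ofReal_re]
  push_cast
  ring

theorem norm_bargmannKernel (d : ℕ) (z : Fin d → ℂ) (x : EuclideanSpace ℝ (Fin d)) :
    ‖bargmannKernel d z x‖ = (2 ^ ((d : ℝ) / 4) * Real.exp (-(Real.pi / 2) * (∑ j, z j ^ 2).re)) *
      Real.exp (-Real.pi * ‖x‖ ^ 2 +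
        inner ℝ ((2 * Real.pi) • WithLp.toLp 2 (fun j => (z j).re)) x) := by
  rw [bargmannKernel, norm_mul, Complex.norm_exp, Complex.norm_real, Real.norm_eq_abs,
    abs_of_nonneg (by positivity), mul_assoc (2 ^ ((d : ℝ) / 4) : ℝ), ← Real.exp_add]
  congr 2
  have h1 : (2 * Real.pi * ∑ j, (x j : ℂ) * z j : ℂ).re = 2 * Real.pi * ∑ j, (z j).re * x j := by
    rw [show (2 * Real.pi : ℂ) = ((2 * Real.pi : ℝ) : ℂ) by push_cast; ring, Complex.re_ofReal_mul]
    simp [mul_comm]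
  have h2 : (Real.pi * ∑ j, (x j : ℂ) ^ 2 : ℂ).re = Real.pi * ‖x‖ ^ 2 := by
    rw [Complex.re_ofReal_mul, EuclideanSpace.norm_sq_eq]
    simp [← Complex.ofReal_pow]
  have h3 : (Real.pi / 2 * ∑ j, z j ^ 2 : ℂ).re = Real.pi / 2 * (∑ j, z j ^ 2).re := by
    rw [show (Real.pi / 2 : ℂ) = ((Real.pi / 2 : ℝ) : ℂ) by push_cast; ring, Complex.re_ofReal_mul]
  have h4 : inner ℝ ((2 * Real.pi) • WithLp.toLp 2 (fun j => (z j).re)) x =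
      2 * Real.pi * ∑ j, (z j).re * x j := by
    rw [real_inner_smul_left]
    simp [PiLp.inner_apply, mul_comm]
  rw [Complex.sub_re, Complex.sub_re, h1, h2, h3, h4]
  ring

theorem memLp_bargmannKernel (d : ℕ) (z : Fin d → ℂ) :
    MemLp (bargmannKernel d z) 2 volume := by
  refine ((memLp_gauss d Real.pi_pos
    ((2 * Real.pi) • WithLp.toLp 2 (fun j => (z j).re))).const_mul
      (2 ^ ((d : ℝ) / 4) * Real.exp (-(Real.pi / 2) * (∑ j, z j ^ 2).re))).of_le
        (continuous_bargmannKernel d z).aestronglyMeasurable (ae_of_all _ fun x => ?_)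
  rw [norm_bargmannKernel]
  exact le_abs_self _

theorem integrable_bargmann (d : ℕ) {f : EuclideanSpace ℝ (Fin d) → ℂ} (hf : MemLp f 2 volume)
    (z : Fin d → ℂ) : Integrable (fun x => bargmannKernel d z x * f x) :=
  (memLp_bargmannKernel d z).integrable_mul hf

theorem differentiable_bargmannFun (d : ℕ) {f : EuclideanSpace ℝ (Fin d) → ℂ}
    (hf : MemLp f 2 volume) : Differentiable ℂ (bargmannFun d f) := by
  intro z₀
  set R : ℝ := ‖z₀‖ + 1 with hR
  set L : ℝ := 4 * Real.pi * d * (R + 1) with hL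
  set C : ℝ := 2 ^ ((d : ℝ) / 4) * Real.exp (2 * Real.pi * d * R ^ 2 + 2 * Real.pi * d * R + L ^ 2) with hC
  let F' : (Fin d → ℂ) → EuclideanSpace ℝ (Fin d) → (Fin d → ℂ) →L[ℂ] ℂ := fun z x =>
    (bargmannKernel d z x * f x) •
      ∑ j, (2 * Real.pi * (x j : ℂ) - Real.pi * z j) • ContinuousLinearMap.proj (R := ℂ) (φ := fun _ : Fin d => ℂ) j
  have hbd : ∀ x : EuclideanSpace ℝ (Fin d), ∀ z ∈ Metric.ball z₀ 1,
      ‖F' z x‖ ≤ C * Real.exp (-(Real.pi / 2) * ‖x‖ ^ 2 + inner ℝ 0 x) * ‖f x‖ := by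
    intro x z hz
    have hzR : ‖z‖ ≤ R := by
      have := norm_sub_norm_le z z₀
      rw [mem_ball_iff_norm] at hz
      linarith
    have hzj : ∀ j, ‖z j‖ ≤ R := fun j => (norm_le_pi_norm z j).trans hzR
    have hxj : ∀ j, |x j| ≤ ‖x‖ := fun j => PiLp.norm_apply_le x j
    have hR0 : 0 ≤ R := by positivity
    have hsum : ‖∑ j, (2 * Real.pi * (x j : ℂ) - Real.pi * z j) •
        ContinuousLinearMap.proj (R := ℂ) (φ := fun _ : Fin d => ℂ) j‖ ≤
        2 * Real.pi * d * ‖x‖ + Real.pi * d * R := by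
      refine (norm_sum_le _ _).trans ?_
      have : ∀ j ∈ (Finset.univ : Finset (Fin d)), ‖(2 * Real.pi * (x j : ℂ) - Real.pi * z j) •
        ContinuousLinearMap.proj (R := ℂ) (φ := fun _ : Fin d => ℂ) j‖ ≤
          2 * Real.pi * ‖x‖ + Real.pi * R := by
        intro j _
        rw [norm_smul]
        have hp : ‖ContinuousLinearMap.proj (R := ℂ) (φ := fun _ : Fin d => ℂ) j‖ ≤ 1 :=
          ContinuousLinearMap.opNorm_le_bound _ zero_le_one fun v => by
            simpa using norm_le_pi_norm v j
        refine (mul_le_of_le_one_right (norm_nonneg _) hp).trans ((norm_sub_le _ _).trans ?_)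
        simp only [norm_mul, Complex.norm_real, Real.norm_eq_abs, abs_of_pos Real.pi_pos,
          Complex.norm_ofNat]
        have := Real.pi_pos
        gcongr
        · exact hxj j
        · exact hzj j
      refine (Finset.sum_le_sum this).trans (le_of_eq ?_)
      simp
      ring
    have hker : ‖bargmannKernel d z x‖ ≤ 2 ^ ((d : ℝ) / 4) *
        Real.exp (2 * Real.pi * d * R * ‖x‖ - Real.pi * ‖x‖ ^ 2 + Real.pi / 2 * d * R ^ 2) := by
      rw [norm_bargmannKernel, mul_assoc, ← Real.exp_add]
      have a1 : -(∑ j, z j ^ 2).re ≤ d * R ^ 2 := by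
        refine (neg_le_abs _).trans ((Complex.abs_re_le_norm _).trans ((norm_sum_le _ _).trans ?_))
        refine (Finset.sum_le_sum (g := fun _ => R ^ 2) fun j _ => ?_).trans (by simp)
        rw [norm_pow]
        exact pow_le_pow_left₀ (norm_nonneg _) (hzj j) 2
      have a2 : inner ℝ ((2 * Real.pi) • WithLp.toLp 2 (fun j => (z j).re)) x ≤
          2 * Real.pi * d * R * ‖x‖ := by
        rw [real_inner_smul_left]
        have : inner ℝ (WithLp.toLp 2 (fun j => (z j).re)) x ≤ d * R * ‖x‖ := by
          rw [PiLp.inner_apply]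
          refine (Finset.sum_le_sum (g := fun _ => R * ‖x‖) fun j _ => ?_).trans (by simp [mul_assoc])
          refine (le_abs_self _).trans ?_
          simp only [RCLike.inner_apply, conj_trivial, abs_mul]
          rw [mul_comm]
          exact mul_le_mul ((Complex.abs_re_le_norm _).trans (hzj j)) (hxj j) (abs_nonneg _) hR0
        have h2 : (0 : ℝ) ≤ 2 * Real.pi := by positivity
        nlinarith [mul_le_mul_of_nonneg_left this h2]
      have a3 := mul_le_mul_of_nonneg_left a1 (by positivity : (0 : ℝ) ≤ Real.pi / 2)
      refine mul_le_mul_of_nonneg_left (Real.exp_le_exp.2 ?_) (by positivity)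
      linarith
    simp only [F']
    rw [norm_smul, norm_mul]
    have hd : (0 : ℝ) ≤ d := by positivity
    calc ‖bargmannKernel d z x‖ * ‖f x‖ * _ ≤ (2 ^ ((d : ℝ) / 4) *
        Real.exp (2 * Real.pi * d * R * ‖x‖ - Real.pi * ‖x‖ ^ 2 + Real.pi / 2 * d * R ^ 2)) * ‖f x‖
          * Real.exp (2 * Real.pi * d * ‖x‖ + Real.pi * d * R) := by
          gcongr
          refine hsum.trans ?_
          have := Real.add_one_le_exp (2 * Real.pi * d * ‖x‖ + Real.pi * d * R)
          linarith
      _ = 2 ^ ((d : ℝ) / 4) * Real.exp ((2 * Real.pi * d * R * ‖x‖ - Real.pi * ‖x‖ ^ 2 +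
          Real.pi / 2 * d * R ^ 2) + (2 * Real.pi * d * ‖x‖ + Real.pi * d * R)) * ‖f x‖ := by
          rw [Real.exp_add _ (2 * Real.pi * d * ‖x‖ + Real.pi * d * R)]
          ring
      _ ≤ _ := by
          rw [hC, mul_assoc _ (Real.exp _) (Real.exp _), ← Real.exp_add]
          have := Real.pi_pos
          have hpi := Real.pi_gt_three
          have e1 : L / 2 * ‖x‖ ≤ Real.pi / 2 * ‖x‖ ^ 2 + L ^ 2 := by
            nlinarith [sq_nonneg (‖x‖ - L / 4), sq_nonneg L, sq_nonneg ‖x‖]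
          have e2 : 2 * Real.pi * d * R * ‖x‖ + 2 * Real.pi * d * ‖x‖ = L / 2 * ‖x‖ := by
            rw [hL]; ring
          have e3 : Real.pi / 2 * d * R ^ 2 ≤ 2 * Real.pi * d * R ^ 2 := by
            gcongr; linarith
          have e4 : Real.pi * d * R ≤ 2 * Real.pi * d * R := by
            gcongr; linarith
          refine mul_le_mul_of_nonneg_right (mul_le_mul_of_nonneg_left (Real.exp_le_exp.2 ?_)
            (by positivity)) (norm_nonneg _)
          rw [inner_zero_left]
          linarith
  have hder : ∀ x : EuclideanSpace ℝ (Fin d), ∀ z,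
      HasFDerivAt (fun z => bargmannKernel d z x * f x) (F' z x) z := by
    intro x z
    have hp : ∀ j, HasFDerivAt (fun z : Fin d → ℂ => z j)
        (ContinuousLinearMap.proj (R := ℂ) (φ := fun _ : Fin d => ℂ) j) z := fun j =>
      (ContinuousLinearMap.proj (R := ℂ) (φ := fun _ : Fin d => ℂ) j).hasFDerivAt
    have h1 := HasFDerivAt.fun_sum (u := Finset.univ) fun j _ => (hp j).const_mul (x j : ℂ)
    have h2 := HasFDerivAt.fun_sum (u := Finset.univ) fun j _ => HasFDerivAt.pow (hp j) 2
    have h3 := (((h1.const_mul (2 * Real.pi : ℂ)).sub_const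
      (Real.pi * ∑ j, (x j : ℂ) ^ 2)).sub (h2.const_mul (Real.pi / 2 : ℂ))).cexp
    have h4 := (h3.const_mul ((2 ^ ((d : ℝ) / 4) : ℝ) : ℂ)).mul_const (f x)
    refine h4.congr_fderiv ?_
    ext v
    simp only [F', bargmannKernel]
    simp
    simp only [Finset.mul_sum, sub_mul, Finset.sum_sub_distrib, mul_sub]
    congr 1 <;> refine Finset.sum_congr rfl fun j _ => ?_ <;> ring
  refine (hasFDerivAt_integral_of_dominated_of_fderiv_le (F := fun z x => bargmannKernel d z x * f x)
    (F' := F') (bound := fun x => C * Real.exp (-(Real.pi / 2) * ‖x‖ ^ 2 + inner ℝ 0 x) * ‖f x‖)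
    (μ := volume)
    (Metric.ball_mem_nhds z₀ one_pos) ?_ ?_ ?_ ?_ ?_ ?_).differentiableAt
  · exact Filter.Eventually.of_forall fun z => (integrable_bargmann d hf z).aestronglyMeasurable
  · exact integrable_bargmann d hf z₀
  · refine (integrable_bargmann d hf z₀).aestronglyMeasurable.smul ?_
    refine Continuous.aestronglyMeasurable ?_
    fun_prop
  · exact ae_of_all _ fun x z hz => hbd x z hz
  · exact ((memLp_gauss d (by positivity : (0 : ℝ) < Real.pi / 2) 0).const_mul C).integrable_mul hf.norm
  · exact ae_of_all _ fun x z _ => hder x z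

theorem measurePreserving_realImag (d : ℕ) :
    MeasurePreserving (fun (p : EuclideanSpace ℝ (Fin d) × EuclideanSpace ℝ (Fin d)) (j : Fin d) =>
      (⟨p.1 j, p.2 j⟩ : ℂ)) volume volume := by
  have h1 := (PiLp.volume_preserving_ofLp (Fin d)).prod (PiLp.volume_preserving_ofLp (Fin d))
  have h2 := (volume_measurePreserving_arrowProdEquivProdArrow ℝ ℝ (Fin d)).symm
  have h3 := volume_preserving_pi (fun _ : Fin d => Complex.volume_preserving_equiv_real_prod.symm)
  exact h3.comp (h2.comp h1)

theorem bargmannFun_eq_fourier (d : ℕ) (f : EuclideanSpace ℝ (Fin d) → ℂ)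
    (a b : EuclideanSpace ℝ (Fin d)) :
    bargmannFun d f (fun j => (⟨a j, b j⟩ : ℂ)) =
      (((2 ^ ((d : ℝ) / 4) : ℝ) : ℂ) * Complex.exp (Real.pi * ∑ j, (a j : ℂ) ^ 2
        - Real.pi / 2 * ∑ j, (⟨a j, b j⟩ : ℂ) ^ 2)) *
      𝓕 (fun x => ((Real.exp (-Real.pi * ‖x - a‖ ^ 2) : ℝ) : ℂ) * f x) (-b) := by
  rw [bargmannFun, Real.fourier_eq', ← integral_const_mul]
  refine integral_congr_ae (ae_of_all _ fun x => ?_)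
  simp only [bargmannKernel, smul_eq_mul, Complex.ofReal_exp]
  simp only [mul_assoc (((2 ^ ((d : ℝ) / 4) : ℝ) : ℂ))]
  rw [← mul_assoc (Complex.exp _) (Complex.exp _) (_ * _), ← Complex.exp_add,
    ← mul_assoc (Complex.exp _) (Complex.exp _) (f x), ← Complex.exp_add]
  congr 3
  have hz : ∀ j, (⟨a j, b j⟩ : ℂ) = a j + b j * Complex.I := fun j => by
    apply Complex.ext <;> simp
  simp only [hz, EuclideanSpace.norm_sq_eq, PiLp.inner_apply, PiLp.neg_apply, PiLp.sub_apply,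
    Real.norm_eq_abs, sq_abs, RCLike.inner_apply, conj_trivial]
  push_cast
  simp only [Finset.mul_sum, Finset.sum_mul, ← Finset.sum_sub_distrib, ← Finset.sum_add_distrib]
  refine Finset.sum_congr rfl fun j _ => ?_
  ring

theorem lintegral_bargmannFun (d : ℕ) {f : EuclideanSpace ℝ (Fin d) → ℂ}
    (hf : MemLp f 2 volume) :
    ∫⁻ z, ‖bargmannFun d f z‖ₑ ^ 2 ∂fockMeasure d = ∫⁻ x, ‖f x‖ₑ ^ 2 := by
  have hpt : ∀ a b : EuclideanSpace ℝ (Fin d),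
      ENNReal.ofReal (Real.exp (-Real.pi * ∑ j, ‖(⟨a j, b j⟩ : ℂ)‖ ^ 2)) *
        ‖bargmannFun d f (fun j => (⟨a j, b j⟩ : ℂ))‖ₑ ^ 2 =
      ENNReal.ofReal (2 ^ ((d : ℝ) / 2)) *
        ‖𝓕 (fun x => ((Real.exp (-Real.pi * ‖x - a‖ ^ 2) : ℝ) : ℂ) * f x) (-b)‖ₑ ^ 2 := by
    intro a b
    rw [bargmannFun_eq_fourier, enorm_mul, mul_pow, ← mul_assoc]
    congr 1
    rw [← ofReal_norm, ← ENNReal.ofReal_pow (norm_nonneg _), ← ENNReal.ofReal_mul (by positivity)]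
    congr 1
    rw [norm_mul, Complex.norm_real, Complex.norm_exp, Real.norm_eq_abs,
      abs_of_nonneg (by positivity), mul_pow, ← Real.exp_nat_mul, ← Real.rpow_mul_natCast (by norm_num),
      mul_left_comm, ← Real.exp_add]
    have : -Real.pi * ∑ j, ‖(⟨a j, b j⟩ : ℂ)‖ ^ 2 + ((2 : ℕ) : ℝ) * (Real.pi * ∑ j, (a j : ℂ) ^ 2
        - Real.pi / 2 * ∑ j, (⟨a j, b j⟩ : ℂ) ^ 2 : ℂ).re = 0 := by
      have h1 : (Real.pi * ∑ j, (a j : ℂ) ^ 2 : ℂ).re = Real.pi * ∑ j, a j ^ 2 := by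
        rw [Complex.re_ofReal_mul]
        simp [← Complex.ofReal_pow]
      have h3 : (Real.pi / 2 * ∑ j, (⟨a j, b j⟩ : ℂ) ^ 2 : ℂ).re =
          Real.pi / 2 * ∑ j, (a j ^ 2 - b j ^ 2) := by
        rw [show (Real.pi / 2 : ℂ) = ((Real.pi / 2 : ℝ) : ℂ) by push_cast; ring,
          Complex.re_ofReal_mul]
        simp [pow_two]
      rw [Complex.sub_re, h1, h3]
      simp only [Complex.sq_norm, Complex.normSq_mk, Finset.mul_sum, ← Finset.sum_sub_distrib,
        ← Finset.sum_add_distrib]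
      refine Finset.sum_eq_zero fun j _ => ?_
      push_cast
      ring
    rw [this, Real.exp_zero, mul_one]
    congr 1
    push_cast
    ring
  have hcont : Continuous (bargmannFun d f) := (differentiable_bargmannFun d hf).continuous
  have hgauss : ∀ a : EuclideanSpace ℝ (Fin d),
      MemLp (fun x => ((Real.exp (-Real.pi * ‖x - a‖ ^ 2) : ℝ) : ℂ)) 2 volume := by
    intro a
    have h := ((memLp_gauss d Real.pi_pos 0).comp_measurePreserving
      (measurePreserving_sub_right volume a)).ofReal (K := ℂ)
    refine h.congr_norm (by fun_prop) (ae_of_all _ fun x => ?_)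
    simp
  have hint : ∀ a : EuclideanSpace ℝ (Fin d),
      Integrable (fun x => ((Real.exp (-Real.pi * ‖x - a‖ ^ 2) : ℝ) : ℂ) * f x) := fun a =>
    (hgauss a).integrable_mul hf
  have hmem : ∀ a : EuclideanSpace ℝ (Fin d),
      MemLp (fun x => ((Real.exp (-Real.pi * ‖x - a‖ ^ 2) : ℝ) : ℂ) * f x) 2 volume := by
    intro a
    refine hf.of_le (hint a).aestronglyMeasurable (ae_of_all _ fun x => ?_)
    rw [norm_mul, Complex.norm_real, Real.norm_eq_abs, Real.abs_exp]
    refine mul_le_of_le_one_left (norm_nonneg _) (Real.exp_le_one_iff.2 ?_)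
    have := Real.pi_pos
    nlinarith [sq_nonneg ‖x - a‖]
  have hmeas : Measurable fun z : Fin d → ℂ => ENNReal.ofReal (Real.exp (-Real.pi * ∑ j, ‖z j‖ ^ 2)) *
      ‖bargmannFun d f z‖ₑ ^ 2 := by
    have := hcont.measurable
    fun_prop
  rw [fockMeasure, lintegral_withDensity_eq_lintegral_mul _ (by fun_prop)
    (by have := hcont.measurable; fun_prop)]
  simp only [Pi.mul_apply]
  rw [← (measurePreserving_realImag d).lintegral_comp hmeas, Measure.volume_eq_prod,
    lintegral_prod _ (by exact (hmeas.comp (measurePreserving_realImag d).measurable).aemeasurable)]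
  simp only [hpt]
  have hplanch : ∀ a : EuclideanSpace ℝ (Fin d),
      ∫⁻ b, ENNReal.ofReal (2 ^ ((d : ℝ) / 2)) *
        ‖𝓕 (fun x => ((Real.exp (-Real.pi * ‖x - a‖ ^ 2) : ℝ) : ℂ) * f x) (-b)‖ₑ ^ 2 =
      ∫⁻ x, ENNReal.ofReal (2 ^ ((d : ℝ) / 2)) *
        (ENNReal.ofReal (Real.exp (-(2 * Real.pi) * ‖x - a‖ ^ 2)) * ‖f x‖ₑ ^ 2) := by
    intro a
    rw [lintegral_const_mul' _ _ ENNReal.ofReal_ne_top, lintegral_const_mul' _ _ ENNReal.ofReal_ne_top]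
    congr 1
    rw [(Measure.measurePreserving_neg volume).lintegral_comp_emb (MeasurableEquiv.neg _).measurableEmbedding
      (fun w => ‖𝓕 (fun x => ((Real.exp (-Real.pi * ‖x - a‖ ^ 2) : ℝ) : ℂ) * f x) w‖ₑ ^ 2),
      lintegral_fourier_sq (hint a) (hmem a)]
    refine lintegral_congr fun x => ?_
    rw [enorm_mul, mul_pow]
    congr 1
    rw [← ofReal_norm, Complex.norm_real, Real.norm_eq_abs, Real.abs_exp,
      ← ENNReal.ofReal_pow (by positivity), ← Real.exp_nat_mul]
    congr 2
    push_cast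
    ring
  simp only [hplanch]
  rw [lintegral_lintegral_swap]
  · refine lintegral_congr fun x => ?_
    have hI : ∫⁻ a : EuclideanSpace ℝ (Fin d),
        ENNReal.ofReal (Real.exp (-(2 * Real.pi) * ‖x - a‖ ^ 2)) =
        ENNReal.ofReal ((2⁻¹ : ℝ) ^ ((d : ℝ) / 2)) := by
      have hi : Integrable fun a : EuclideanSpace ℝ (Fin d) => Real.exp (-(2 * Real.pi) * ‖a‖ ^ 2) := by
        have := (memLp_two_iff_integrable_sq_norm (by fun_prop)).1 (memLp_gauss d Real.pi_pos 0)
        refine this.congr (ae_of_all _ fun a => ?_)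
        simp only [inner_zero_left, add_zero, Real.norm_eq_abs, Real.abs_exp, ← Real.exp_nat_mul]
        congr 1
        push_cast
        ring
      rw [(Measure.measurePreserving_sub_left volume x).lintegral_comp
        (f := fun a => ENNReal.ofReal (Real.exp (-(2 * Real.pi) * ‖a‖ ^ 2))) (by fun_prop),
        ← ofReal_integral_eq_lintegral_ofReal hi (ae_of_all _ fun a => (Real.exp_pos _).le),
        GaussianFourier.integral_rexp_neg_mul_sq_norm (by positivity)]
      congr 2
      · have := Real.pi_pos.ne'
        field_simp
      · simp
    simp only [← mul_assoc]
    rw [lintegral_mul_const' _ _ (by simp), lintegral_const_mul' _ _ ENNReal.ofReal_ne_top, hI,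
      ← ENNReal.ofReal_mul (by positivity), ← Real.mul_rpow (by norm_num) (by norm_num)]
    simp
  · have h1 : Measurable fun p : EuclideanSpace ℝ (Fin d) × EuclideanSpace ℝ (Fin d) =>
        ENNReal.ofReal (Real.exp (-(2 * Real.pi) * ‖p.2 - p.1‖ ^ 2)) := by fun_prop
    have h2 : AEMeasurable (fun p : EuclideanSpace ℝ (Fin d) × EuclideanSpace ℝ (Fin d) =>
        ‖f p.2‖ₑ ^ 2) (volume.prod volume) :=
      (hf.aestronglyMeasurable.enorm.pow_const 2).comp_snd
    exact (h1.aemeasurable.mul h2).const_mul _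

theorem memLp_bargmannFun (d : ℕ) {f : EuclideanSpace ℝ (Fin d) → ℂ} (hf : MemLp f 2 volume) :
    MemLp (bargmannFun d f) 2 (fockMeasure d) := by
  refine ⟨(differentiable_bargmannFun d hf).continuous.aestronglyMeasurable, ?_⟩
  rw [eLpNorm_lt_top_iff_lintegral_rpow_enorm_lt_top (by norm_num) (by norm_num)]
  have := (eLpNorm_lt_top_iff_lintegral_rpow_enorm_lt_top (by norm_num) (by norm_num)).1 hf.2
  simpa [lintegral_bargmannFun d hf] using this

theorem eLpNorm_bargmannFun (d : ℕ) {f : EuclideanSpace ℝ (Fin d) → ℂ} (hf : MemLp f 2 volume) :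
    eLpNorm (bargmannFun d f) 2 (fockMeasure d) = eLpNorm f 2 volume := by
  rw [eLpNorm_eq_lintegral_rpow_enorm_toReal (p := 2) (by norm_num) (by norm_num),
    eLpNorm_eq_lintegral_rpow_enorm_toReal (p := 2) (by norm_num) (by norm_num)]
  congr 1
  simpa using lintegral_bargmannFun d hf

/-- The Fock (Segal–Bargmann) space: the elements of `L²(ℂ^d, e^{-π|z|²} dz)` that are represented
by an entire function. -/
def fockSpace (d : ℕ) : Submodule ℂ (Lp ℂ 2 (fockMeasure d)) where
  carrier := {F | ∃ h : (Fin d → ℂ) → ℂ, Differentiable ℂ h ∧ F =ᵐ[fockMeasure d] h}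
  zero_mem' := ⟨0, differentiable_const 0, Lp.coeFn_zero ℂ 2 (fockMeasure d)⟩
  add_mem' := by
    rintro F G ⟨f, hf, hF⟩ ⟨g, hg, hG⟩
    exact ⟨f + g, hf.add hg, (Lp.coeFn_add F G).trans (hF.add hG)⟩
  smul_mem' := by
    rintro c F ⟨f, hf, hF⟩
    exact ⟨c • f, hf.const_smul c, (Lp.coeFn_smul c F).trans (hF.const_smul c)⟩

theorem bargmannFun_add (d : ℕ) (f g : L2Config d) :
    bargmannFun d (f + g : L2Config d) = bargmannFun d f + bargmannFun d g := by
  ext z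
  simp only [bargmannFun, Pi.add_apply]
  rw [← integral_add (integrable_bargmann d (Lp.memLp f) z) (integrable_bargmann d (Lp.memLp g) z)]
  refine integral_congr_ae ?_
  filter_upwards [Lp.coeFn_add f g] with x hx
  rw [hx, Pi.add_apply, mul_add]

theorem bargmannFun_smul (d : ℕ) (c : ℂ) (f : L2Config d) :
    bargmannFun d (c • f : L2Config d) = c • bargmannFun d f := by
  ext z
  simp only [bargmannFun, Pi.smul_apply, smul_eq_mul]
  rw [← integral_const_mul]
  refine integral_congr_ae ?_
  filter_upwards [Lp.coeFn_smul c f] with x hx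
  rw [hx, Pi.smul_apply, smul_eq_mul, mul_left_comm]

/-- The Bargmann transform as an isometry of `L²(ℝ^d)` into `L²(ℂ^d, e^{-π|z|²} dz)`. -/
def bargmannIsometry (d : ℕ) : L2Config d →ₗᵢ[ℂ] Lp ℂ 2 (fockMeasure d) where
  toFun f := (memLp_bargmannFun d (Lp.memLp f)).toLp (bargmannFun d f)
  map_add' f g := by
    rw [← MemLp.toLp_add]
    exact MemLp.toLp_congr _ _ (by rw [bargmannFun_add])
  map_smul' c f := by
    rw [RingHom.id_apply, ← MemLp.toLp_const_smul]
    exact MemLp.toLp_congr _ _ (by rw [bargmannFun_smul])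
  norm_map' f := by
    change ‖(memLp_bargmannFun d (Lp.memLp f)).toLp (bargmannFun d f)‖ = ‖f‖
    rw [Lp.norm_toLp, eLpNorm_bargmannFun d (Lp.memLp f), Lp.norm_def]

/-- The Bargmann transform `L²(ℝ^d) → 𝔉^d`. -/
def bargmann (d : ℕ) : L2Config d →ₗ[ℂ] fockSpace d :=
  (bargmannIsometry d).toLinearMap.codRestrict (fockSpace d) fun f =>
    ⟨bargmannFun d f, differentiable_bargmannFun d (Lp.memLp f),
      MemLp.coeFn_toLp (memLp_bargmannFun d (Lp.memLp f))⟩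

/-- The adjoint `𝔉^d → L²(ℝ^d)` of the Bargmann transform. -/
def bargmannAdjoint (d : ℕ) : fockSpace d →ₗ[ℂ] L2Config d :=
  (ContinuousLinearMap.adjoint (bargmannIsometry d).toContinuousLinearMap).toLinearMap ∘ₗ
    (fockSpace d).subtype

theorem memLp_polynomial (d : ℕ) (p : MvPolynomial (Fin d) ℂ) :
    MemLp (fun z : Fin d → ℂ => MvPolynomial.eval z p) 2 (fockMeasure d) := by
  have hcont : ∀ q : MvPolynomial (Fin d) ℂ, Continuous fun z : Fin d → ℂ => MvPolynomial.eval z q :=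
    fun q => MvPolynomial.continuous_eval q
  have hmono : ∀ m : Fin d →₀ ℕ,
      MemLp (fun z : Fin d → ℂ => ∏ i, z i ^ m i) 2 (fockMeasure d) := by
    intro m
    have hc : Continuous fun z : Fin d → ℂ => ∏ i, z i ^ m i := by fun_prop
    rw [memLp_two_iff_integrable_sq_norm hc.aestronglyMeasurable, fockMeasure,
      integrable_withDensity_iff (by fun_prop) (ae_of_all _ fun _ => ENNReal.ofReal_lt_top)]
    have hg : Integrable fun w : ℂ => Real.exp (-(Real.pi / 2) * ‖w‖ ^ 2) := by
      have := (GaussianFourier.integrable_cexp_neg_mul_sq_norm_add (b := ((Real.pi / 2 : ℝ) : ℂ))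
        (V := ℂ) (by simp [Real.pi_pos]) 0 0).norm
      refine this.congr (ae_of_all _ fun w => ?_)
      simp only [Complex.norm_exp]
      congr 1
      rw [zero_mul, add_zero, ← Complex.ofReal_neg, ← Complex.ofReal_pow, ← Complex.ofReal_mul,
        Complex.ofReal_re]
    have hint := (Integrable.fintype_prod (f := fun (_ : Fin d) (w : ℂ) =>
      Real.exp (-(Real.pi / 2) * ‖w‖ ^ 2)) fun _ => hg).const_mul
        (∏ i : Fin d, Real.exp ((m i : ℝ) ^ 2))
    refine hint.mono' (by fun_prop) (ae_of_all _ fun z => ?_)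
    rw [ENNReal.toReal_ofReal (Real.exp_pos _).le, norm_mul, Real.norm_eq_abs, Real.norm_eq_abs,
      Real.abs_exp, abs_of_nonneg (by positivity), norm_prod, ← Finset.prod_pow, Finset.mul_sum,
      Real.exp_sum, ← Finset.prod_mul_distrib, ← Finset.prod_mul_distrib]
    refine Finset.prod_le_prod (fun i _ => by positivity) fun i _ => ?_
    have h1 : ‖z i ^ m i‖ ^ 2 ≤ Real.exp (2 * m i * ‖z i‖) := by
      rw [norm_pow, ← pow_mul, mul_comm (m i) 2,
        show 2 * (m i : ℝ) * ‖z i‖ = ((2 * m i : ℕ) : ℝ) * ‖z i‖ by push_cast; ring, Real.exp_nat_mul]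
      refine pow_le_pow_left₀ (norm_nonneg _) ?_ _
      linarith [Real.add_one_le_exp ‖z i‖]
    refine (mul_le_mul_of_nonneg_right h1 (Real.exp_pos _).le).trans ?_
    rw [← Real.exp_add, ← Real.exp_add]
    refine Real.exp_le_exp.2 ?_
    nlinarith [sq_nonneg (‖z i‖ - m i), Real.pi_gt_three, sq_nonneg ‖z i‖]
  have : (fun z : Fin d → ℂ => MvPolynomial.eval z p) =
      fun z => ∑ m ∈ p.support, MvPolynomial.coeff m p * ∏ i, z i ^ m i := by
    ext z
    rw [MvPolynomial.eval_eq']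
  rw [this]
  exact memLp_finsetSum _ fun m _ => (hmono m).const_mul _

/-- A polynomial in `z_1, …, z_d`, as an element of the Fock space. -/
def fockPolynomial (d : ℕ) : MvPolynomial (Fin d) ℂ →ₗ[ℂ] fockSpace d where
  toFun p := ⟨(memLp_polynomial d p).toLp _, fun z => MvPolynomial.eval z p, by
    have : (fun z : Fin d → ℂ => MvPolynomial.eval z p) =
        fun z => ∑ m ∈ p.support, MvPolynomial.coeff m p * ∏ i, z i ^ m i := by
      ext z
      rw [MvPolynomial.eval_eq']
    rw [this]
    fun_prop, MemLp.coeFn_toLp _⟩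
  map_add' p q := by
    ext1
    simp only [Submodule.coe_add, ← MemLp.toLp_add]
    exact MemLp.toLp_congr _ _ (ae_of_all _ fun z => by simp)
  map_smul' c p := by
    ext1
    simp only [Submodule.coe_smul, RingHom.id_apply, ← MemLp.toLp_const_smul]
    exact MemLp.toLp_congr _ _ (ae_of_all _ fun z => by simp)

theorem fockPolynomial_injective (d : ℕ) : Function.Injective (fockPolynomial d) := by
  intro p q h
  have h1 : (fun z : Fin d → ℂ => MvPolynomial.eval z p) =ᵐ[fockMeasure d]
      fun z => MvPolynomial.eval z q := by
    have h2 := congrArg Subtype.val h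
    exact (MemLp.toLp_eq_toLp_iff (memLp_polynomial d p) (memLp_polynomial d q)).1 h2
  have h3 : (fun z : Fin d → ℂ => MvPolynomial.eval z p) =ᵐ[volume]
      fun z => MvPolynomial.eval z q := by
    rw [fockMeasure] at h1
    rw [Filter.EventuallyEq, ae_withDensity_iff (by fun_prop)] at h1
    filter_upwards [h1] with z hz
    exact hz (by simp [Real.exp_pos])
  have h4 := (MvPolynomial.continuous_eval p).ae_eq_iff_eq volume (MvPolynomial.continuous_eval q) |>.1 h3
  exact MvPolynomial.funext fun z => congrFun h4 z

/-- The linear map on the symmetric power induced by a symmetric multilinear map. -/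
def symmetricPowerLift {V W : Type} [AddCommGroup V] [Module ℂ V] [AddCommGroup W] [Module ℂ W]
    {k : ℕ} (f : MultilinearMap ℂ (fun _ : Fin k => V) W)
    (hf : ∀ (e : Equiv.Perm (Fin k)) (v : Fin k → V), f (fun i => v (e i)) = f v) :
    SymmetricPower ℂ (Fin k) V →ₗ[ℂ] W where
  __ := AddCon.lift (addConGen (SymmetricPower.Rel ℂ (Fin k) V))
    (PiTensorProduct.lift f).toAddMonoidHom (by
      rw [AddCon.addConGen_le]
      rintro _ _ ⟨e, v⟩
      rw [AddCon.ker_apply]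
      rw [LinearMap.toAddMonoidHom_coe, PiTensorProduct.lift.tprod, PiTensorProduct.lift.tprod, hf])
  map_smul' c x := by
    induction x using AddCon.induction_on with
    | H x => exact map_smul (PiTensorProduct.lift f) c x

theorem symmetricPowerLift_tprod {V W : Type} [AddCommGroup V] [Module ℂ V] [AddCommGroup W]
    [Module ℂ W] {k : ℕ} (f : MultilinearMap ℂ (fun _ : Fin k => V) W)
    (hf : ∀ (e : Equiv.Perm (Fin k)) (v : Fin k → V), f (fun i => v (e i)) = f v)
    (v : Fin k → V) : symmetricPowerLift f hf (SymmetricPower.tprod ℂ v) = f v :=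
  PiTensorProduct.lift.tprod v

/-- The linear form `∑ v_j z_j` attached to `v ∈ ℂ^d`. -/
def linearPolynomial (d : ℕ) : (Fin d → ℂ) →ₗ[ℂ] MvPolynomial (Fin d) ℂ :=
  Fintype.linearCombination ℂ (MvPolynomial.X (R := ℂ) (σ := Fin d))

/-- The linear map `v_1 ⊙ ⋯ ⊙ v_k ↦ ∏ (∑ (v_i)_j z_j)` to polynomials; in particular
`e_{j_1} ⊙ ⋯ ⊙ e_{j_k} ↦ z_{j_1} ⋯ z_{j_k}`. -/
def symmetricToPolynomial (d k : ℕ) :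
    SymmetricPower ℂ (Fin k) (Fin d → ℂ) →ₗ[ℂ] MvPolynomial (Fin d) ℂ :=
  symmetricPowerLift
    ((MultilinearMap.mkPiAlgebra ℂ (Fin k) (MvPolynomial (Fin d) ℂ)).compLinearMap
      fun _ => linearPolynomial d)
    fun e v => by
      simp only [MultilinearMap.compLinearMap_apply, MultilinearMap.mkPiAlgebra_apply]
      exact Equiv.prod_comp e fun i => linearPolynomial d (v i)

theorem symmetricToPolynomial_basis (d k : ℕ) (j : Fin k → Fin d) :
    symmetricToPolynomial d k (SymmetricPower.tprod ℂ fun i => Pi.single (j i) (1 : ℂ)) =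
      ∏ i, MvPolynomial.X (j i) := by
  rw [symmetricToPolynomial, symmetricPowerLift_tprod]
  simp [linearPolynomial]

theorem span_symmetric_basis (d k : ℕ) :
    Submodule.span ℂ (Set.range fun j : Fin k → Fin d =>
      SymmetricPower.tprod ℂ fun i => (Pi.single (j i) 1 : Fin d → ℂ)) = ⊤ := by
  rw [eq_top_iff, ← SymmetricPower.span_tprod_eq_top, Submodule.span_le]
  rintro _ ⟨v, rfl⟩
  have hv : v = fun i => ∑ j, v i j • (Pi.single j 1 : Fin d → ℂ) := by
    ext i l
    simp [Pi.single_apply]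
  rw [hv, MultilinearMap.map_sum]
  refine Submodule.sum_mem _ fun j _ => ?_
  rw [MultilinearMap.map_smul_univ]
  exact Submodule.smul_mem _ _ (Submodule.subset_span ⟨j, rfl⟩)

theorem symmetricToPolynomial_injective (d k : ℕ) :
    Function.Injective (symmetricToPolynomial d k) := by
  classical
  let e : (Fin k → Fin d) → SymmetricPower ℂ (Fin k) (Fin d → ℂ) := fun j =>
    SymmetricPower.tprod ℂ fun i => (Pi.single (j i) 1 : Fin d → ℂ)
  let c : (Fin k → Fin d) → (Fin d →₀ ℕ) := fun j => ∑ i, Finsupp.single (j i) 1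
  have hc : ∀ j j', c j = c j' → e j = e j' := by
    intro j j' h
    have hcard : ∀ a, Fintype.card {i // j i = a} = Fintype.card {i // j' i = a} := by
      intro a
      have h1 := DFunLike.congr_fun h a
      simpa [c, Finsupp.finsetSum_apply, Finsupp.single_apply, Fintype.card_subtype] using h1
    obtain ⟨σ, hσ⟩ : ∃ σ : Equiv.Perm (Fin k), (fun i => j' (σ i)) = j := by
      refine ⟨(Equiv.sigmaFiberEquiv j).symm.trans ((Equiv.sigmaCongrRight fun a =>
        Fintype.equivOfCardEq (hcard a)).trans (Equiv.sigmaFiberEquiv j')), ?_⟩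
      ext1 i
      exact ((Fintype.equivOfCardEq (hcard (j i))) ⟨i, rfl⟩).2
    rw [← hσ]
    exact SymmetricPower.tprod_equiv σ fun i => (Pi.single (j' i) 1 : Fin d → ℂ)
  let L : MvPolynomial (Fin d) ℂ →ₗ[ℂ] SymmetricPower ℂ (Fin k) (Fin d → ℂ) :=
    (MvPolynomial.basisMonomials (Fin d) ℂ).constr ℂ fun m =>
      if h : ∃ j, c j = m then e h.choose else 0
  have hL : L ∘ₗ symmetricToPolynomial d k = LinearMap.id := by
    refine LinearMap.ext_on (span_symmetric_basis d k) ?_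
    rintro _ ⟨j, rfl⟩
    have hm : (∏ i, MvPolynomial.X (R := ℂ) (j i)) = MvPolynomial.basisMonomials (Fin d) ℂ (c j) := by
      simp only [c, MvPolynomial.coe_basisMonomials, MvPolynomial.X]
      rw [MvPolynomial.monomial_sum_one]
    have hex : ∃ j', c j' = c j := ⟨j, rfl⟩
    rw [LinearMap.comp_apply, symmetricToPolynomial_basis, hm, Module.Basis.constr_basis, dif_pos hex]
    exact hc _ _ hex.choose_spec
  exact Function.LeftInverse.injective (g := L) fun x => LinearMap.congr_fun hL x

/-- The space `𝔉^d_k` spanned by the monomials `z_{j_1} ⋯ z_{j_k}` of total degree `k`. -/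
def fockHomogeneous (d k : ℕ) : Submodule ℂ (fockSpace d) :=
  Submodule.span ℂ (Set.range fun j : Fin k → Fin d =>
    fockPolynomial d (∏ i, MvPolynomial.X (j i)))

theorem range_symmetricToFock (d k : ℕ) :
    LinearMap.range (fockPolynomial d ∘ₗ symmetricToPolynomial d k) = fockHomogeneous d k := by
  rw [LinearMap.range_eq_map, ← span_symmetric_basis d k, Submodule.map_span, ← Set.range_comp,
    fockHomogeneous]
  congr 2
  ext j : 1
  simp only [Function.comp_apply, LinearMap.comp_apply, symmetricToPolynomial_basis]

/-- The isomorphism `T_k : S^k(ℂ^d) → 𝔉^d_k` with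
`T_k (e_{j_1} ⊙ ⋯ ⊙ e_{j_k}) = z_{j_1} ⋯ z_{j_k}`. -/
def symmetricToFock (d k : ℕ) :
    SymmetricPower ℂ (Fin k) (Fin d → ℂ) ≃ₗ[ℂ] fockHomogeneous d k :=
  LinearEquiv.ofInjective (fockPolynomial d ∘ₗ symmetricToPolynomial d k)
      ((fockPolynomial_injective d).comp (symmetricToPolynomial_injective d k)) ≪≫ₗ
    LinearEquiv.ofEq _ _ (range_symmetricToFock d k)

theorem symmetricToFock_basis (d k : ℕ) (j : Fin k → Fin d) :
    (symmetricToFock d k (SymmetricPower.tprod ℂ fun i => Pi.single (j i) (1 : ℂ)) : fockSpace d) =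
      fockPolynomial d (∏ i, MvPolynomial.X (j i)) :=
  congrArg (fockPolynomial d) (symmetricToPolynomial_basis d k j)

/-- For `w = (p, q) ∈ ℝ^d × ℝ^d`, the operator `e^{2πi(p·D + q·X)}` on `L²(ℝ^d)`, where
`D = (2πi)⁻¹ ∂` and `X` is multiplication by `x`: it sends `f` to
`x ↦ e^{2πi q·x + πi p·q} f(x + p)`. It is the Weyl quantization at `ħ = 1/(2π)` of the symbol
`(ξ, x) ↦ e^{2πi(p·ξ + q·x)}`. -/
def heisenberg (d : ℕ) (w : Fin d ⊕ Fin d → ℝ) (f : L2Config d) : L2Config d :=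
  MemLp.toLp (fun x : EuclideanSpace ℝ (Fin d) =>
    Complex.exp (((2 * Real.pi * ∑ j, w (Sum.inr j) * x j
      + Real.pi * ∑ j, w (Sum.inl j) * w (Sum.inr j) : ℝ) : ℂ) * Complex.I) *
      f (x + WithLp.toLp 2 fun j => w (Sum.inl j))) (by
    have h := (Lp.memLp f).comp_measurePreserving
      (measurePreserving_add_right volume (WithLp.toLp 2 fun j : Fin d => w (Sum.inl j)))
    refine h.of_le (AEStronglyMeasurable.mul (Continuous.aestronglyMeasurable (by fun_prop))
      h.aestronglyMeasurable) (ae_of_all _ fun x => ?_)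
    rw [norm_mul, Complex.norm_exp_ofReal_mul_I, one_mul]
    rfl)

/-- A metaplectic representation (at `ħ = 1/(2π)`) of the real symplectic group on `L²(ℝ^d)`: a map
into the unitary operators that implements the action of the symplectic group on the Heisenberg
operators (the exact Egorov relation `Op(σ ∘ Sᵀ) = μ(S) Op(σ) μ(S)⁻¹` for the exponential symbols
`σ(ξ, x) = e^{2πi(p·ξ + q·x)}`) and is multiplicative up to sign. Such a map is unique up to the
choice of the sign of each operator `μ(S)`. -/
structure IsMetaplectic (d : ℕ)
    (μ : Matrix.symplecticGroup (Fin d) ℝ → (L2Config d ≃ₗᵢ[ℂ] L2Config d)) : Prop where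
  intertwines : ∀ (S : Matrix.symplecticGroup (Fin d) ℝ) (w : Fin d ⊕ Fin d → ℝ) (f : L2Config d),
    μ S (heisenberg d w f) =
      heisenberg d (Matrix.mulVec (S : Matrix (Fin d ⊕ Fin d) (Fin d ⊕ Fin d) ℝ) w) (μ S f)
  mul_up_to_sign : ∀ S T : Matrix.symplecticGroup (Fin d) ℝ,
    (∀ f, μ (S * T) f = μ S (μ T f)) ∨ (∀ f, μ (S * T) f = -μ S (μ T f))

/-- The inclusion of `U(d)` in the symplectic group given by the identification
`(p, q) ↦ p + i q` of `ℝ^d × ℝ^d` with `ℂ^d`. -/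
def unitaryToSymplectic (d : ℕ) (g : Matrix.unitaryGroup (Fin d) ℂ) :
    Matrix.symplecticGroup (Fin d) ℝ :=
  ⟨Matrix.fromBlocks ((g : Matrix (Fin d) (Fin d) ℂ).map Complex.re)
      (-(g : Matrix (Fin d) (Fin d) ℂ).map Complex.im)
      ((g : Matrix (Fin d) (Fin d) ℂ).map Complex.im)
      ((g : Matrix (Fin d) (Fin d) ℂ).map Complex.re), by
    have hg := (Matrix.mem_unitaryGroup_iff).1 g.2
    have hre : ∀ i k, ∑ j, ((g.1 i j).re * (g.1 k j).re + (g.1 i j).im * (g.1 k j).im) =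
        (1 : Matrix (Fin d) (Fin d) ℝ) i k := by
      intro i k
      have h := congrArg Complex.re (congrFun (congrFun hg i) k)
      simpa [Matrix.mul_apply, Matrix.star_apply, Matrix.one_apply, apply_ite] using h
    have him : ∀ i k, ∑ j, ((g.1 i j).im * (g.1 k j).re - (g.1 i j).re * (g.1 k j).im) = 0 := by
      intro i k
      have h := congrArg Complex.im (congrFun (congrFun hg i) k)
      simpa [Matrix.mul_apply, Matrix.star_apply, Matrix.one_apply, apply_ite,
        sub_eq_neg_add] using h
    rw [SymplecticGroup.mem_iff, Matrix.J, Matrix.fromBlocks_transpose, Matrix.fromBlocks_multiply,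
      Matrix.fromBlocks_multiply]
    congr 1 <;> ext i k
    · have h := him i k
      simp only [Finset.sum_sub_distrib] at h
      simp [Matrix.mul_apply]
      linarith
    · have h := hre i k
      simp only [Finset.sum_add_distrib] at h
      simp [Matrix.mul_apply]
      linarith
    · have h := hre i k
      simp only [Finset.sum_add_distrib] at h
      simp [Matrix.mul_apply]
      linarith
    · have h := him i k
      simp only [Finset.sum_sub_distrib] at h
      simp [Matrix.mul_apply]
      linarith⟩

theorem unitaryToSymplectic_mulVec (d : ℕ) (g : Matrix.unitaryGroup (Fin d) ℂ)
    (w : Fin d ⊕ Fin d → ℝ) (j : Fin d) :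
    (⟨Matrix.mulVec (unitaryToSymplectic d g : Matrix (Fin d ⊕ Fin d) (Fin d ⊕ Fin d) ℝ) w (Sum.inl j),
      Matrix.mulVec (unitaryToSymplectic d g : Matrix (Fin d ⊕ Fin d) (Fin d ⊕ Fin d) ℝ) w
        (Sum.inr j)⟩ : ℂ) =
      Matrix.mulVec (g : Matrix (Fin d) (Fin d) ℂ)
        (fun i => (⟨w (Sum.inl i), w (Sum.inr i)⟩ : ℂ)) j := by
  apply Complex.ext <;>
    simp [unitaryToSymplectic, Matrix.mulVec, dotProduct, Finset.sum_add_distrib,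
      sub_eq_add_neg, add_comm]

/-- The operator `ν = B̂ U B̂*` on the Fock space, for an operator `U` on `L²(ℝ^d)` and the Bargmann
transform `B̂`. -/
def fockOperator (d : ℕ) (U : L2Config d ≃ₗᵢ[ℂ] L2Config d) : fockSpace d →ₗ[ℂ] fockSpace d :=
  bargmann d ∘ₗ U.toLinearEquiv.toLinearMap ∘ₗ bargmannAdjoint d

/-- The operator `T_k⁻¹ N_k T_k` on `S^k(ℂ^d)`, where `N_k` is the restriction to `𝔉^d_k` of an
operator `N` on the Fock space that leaves `𝔉^d_k` invariant. -/
def transportToSymmetric (d k : ℕ) (N : fockSpace d →ₗ[ℂ] fockSpace d)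
    (hN : ∀ F ∈ fockHomogeneous d k, N F ∈ fockHomogeneous d k) :
    SymmetricPower ℂ (Fin k) (Fin d → ℂ) →ₗ[ℂ] SymmetricPower ℂ (Fin k) (Fin d → ℂ) :=
  (symmetricToFock d k).symm.toLinearMap ∘ₗ N.restrict hN ∘ₗ (symmetricToFock d k).toLinearMap

end

/-!
Let `φ₀` be the Gaussian vacuum, whose Bargmann transform is the constant `1`, and let `S_g` be the
symplectic matrix of a unitary matrix `g`.

*The form of `ν(g)`.* A nonzero `φ ∈ L²(ℝ^d)` is determined up to a scalar by the function
`w ↦ ⟪φ, ρ(w) φ⟫`: for fixed `p` it is a Fourier transform in `q`, so it determines the products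
`φ(x + p) φ̄(x)` (`exists_smul_of_inner_heisenberg_eq`). For `φ₀` this function is `e^{-π|w|²/2}`,
which is invariant under unitary matrices, so `μ(S_g) φ₀ = c(g) φ₀` with `|c(g)| = 1`. Since
`(B̂f)(z)` is a Gaussian factor times `⟪ρ(-z) φ₀, f⟫`, the intertwining relation gives
`(B̂ μ(S_g) f)(g z) = c(g) (B̂f)(z)` (`IsMetaplectic.bargmannFun_apply`). Polynomials lie in the range
of `B̂`, because `B̂` turns the creation operators into multiplication by the coordinates
(`bargmannFun_creation`). Hence `ν(g)` acts on polynomials by `F ↦ c(g) F ∘ g⁻¹`, which is `c(g)`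
times the symmetric power of `ḡ` on products of linear forms.

*The value of `c(g)²`.* By multiplicativity up to sign, `χ(g) = c(g)²` is a character of the unitary
group; nothing is assumed about its continuity. The coherent states `ρ(w) φ₀` span a dense subspace,
so an isometry that implements a given transformation of the Heisenberg operators is unique up to a
scalar (`exists_smul_of_intertwines`). In particular `μ` of the shear `(p, q) ↦ (p, q + s p)`,
`s ∈ ℝ^d`, is a scalar `ζ(s)` times multiplication by `e^{-πi Σ s_j x_j²}`, and `ζ²` is an additive
character of `ℝ^d`. With `a = s/2` and `k = (1 - i a)/√(1 + a²)`, in each coordinate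
`k · shear(s) · k = J · shear(-s) · J⁻¹`, where `J` is multiplication by `i`. The squared vacuum
expectations of the two sides are Gaussian integrals, and they yield
`χ(diag λ(a)) ∏ λ(a_j) = ζ(-2a)⁴` for the Cayley transform `λ(a) = k² = (1 - i a)/(1 + i a)`
(`IsMetaplectic.vacuumCharacter_cayley_mul_prod`). The left side is multiplicative in `λ(a)`, the right
side is additive in `a`. For `a b = -1` the tangent addition theorem reads
`λ(a) λ(b) = λ((a + b)/2)`, and comparison gives `ζ⁴ = 1` (`IsMetaplectic.shearFactor_sq`), so
`χ = det⁻¹` on the matrices `diag λ(a)`. A unitary matrix without eigenvalue `-1` is unitarily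
conjugate to such a matrix, and any unitary matrix is the product of one such and a scalar `λ(t)`.
-/

/-! ### Matrix coefficients of the Heisenberg operators -/

theorem ae_eq_zero_of_fourier_eq_zero {V : Type*} [NormedAddCommGroup V] [InnerProductSpace ℝ V]
    [FiniteDimensional ℝ V] [MeasurableSpace V] [BorelSpace V] {h : V → ℂ}
    (hi : Integrable h) (h0 : ∀ w, 𝓕 h w = 0) : ∀ᵐ x, h x = 0 := by
  refine ae_eq_zero_of_integral_contDiff_smul_eq_zero hi.locallyIntegrable ?_
  intro g hg hgs
  let g' : V → ℂ := fun x => (g x : ℂ)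
  have hg's : HasCompactSupport g' := hgs.comp_left (g := fun r : ℝ => (r : ℂ)) (by simp)
  have hg'c : ContDiff ℝ ∞ g' := Complex.ofRealCLM.contDiff.comp hg
  let φ : 𝓢(V, ℂ) := hg's.toSchwartzMap hg'c
  have hφ : ∀ x, φ x = g' x := fun x => rfl
  have key := VectorFourier.integral_fourierIntegral_smul_eq_flip (μ := volume) (ν := volume)
    (L := innerₗ V) (f := (𝓕⁻ φ : 𝓢(V, ℂ))) (g := h) Real.continuous_fourierChar
    (by exact continuous_inner) (𝓕⁻ φ : 𝓢(V, ℂ)).integrable hi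
  have e3 : (innerₗ V).flip = innerₗ V := by ext x y; simp
  rw [e3] at key
  have e1 : ∫ x, (𝓕 (𝓕⁻ φ : 𝓢(V, ℂ))) x • h x = ∫ x, (𝓕⁻ φ : 𝓢(V, ℂ)) x • 𝓕 h x := key
  rw [FourierTransform.fourier_fourierInv_eq] at e1
  simpa [h0, hφ, g'] using e1

theorem heisenberg_coeFn (d : ℕ) (w : Fin d ⊕ Fin d → ℝ) (f : L2Config d) :
    heisenberg d w f =ᵐ[volume] fun x : EuclideanSpace ℝ (Fin d) =>
      Complex.exp (((2 * Real.pi * ∑ j, w (Sum.inr j) * x j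
        + Real.pi * ∑ j, w (Sum.inl j) * w (Sum.inr j) : ℝ) : ℂ) * Complex.I) *
      f (x + WithLp.toLp 2 fun j => w (Sum.inl j)) :=
  MemLp.coeFn_toLp _

theorem ae_comp_add_right {d : ℕ} {P : EuclideanSpace ℝ (Fin d) → Prop}
    (h : ∀ᵐ x, P x) (p : EuclideanSpace ℝ (Fin d)) : ∀ᵐ x, P (x + p) :=
  (measurePreserving_add_right volume p).quasiMeasurePreserving.ae h

theorem heisenberg_smul (d : ℕ) (w : Fin d ⊕ Fin d → ℝ) (c : ℂ) (f : L2Config d) :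
    heisenberg d w (c • f) = c • heisenberg d w f := by
  refine Lp.ext ?_
  filter_upwards [heisenberg_coeFn d w (c • f), heisenberg_coeFn d w f,
    Lp.coeFn_smul c (heisenberg d w f),
    ae_comp_add_right (Lp.coeFn_smul c f) (WithLp.toLp 2 fun j => w (Sum.inl j))]
    with x h1 h2 h3 h4
  rw [h1, h3, Pi.smul_apply, h2, h4, Pi.smul_apply, smul_eq_mul, smul_eq_mul]
  ring

/-- For fixed `p`, the matrix coefficient `⟪ψ, ρ(p, q) φ⟫` is, up to a phase, the Fourier transform
of `x ↦ φ (x + p) ψ̄ (x)` at `-q`. -/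
theorem inner_heisenberg (d : ℕ) (w : Fin d ⊕ Fin d → ℝ) (ψ φ : L2Config d) :
    inner ℂ ψ (heisenberg d w φ) =
      Complex.exp (((Real.pi * ∑ j, w (Sum.inl j) * w (Sum.inr j) : ℝ) : ℂ) * Complex.I) *
      𝓕 (fun x : EuclideanSpace ℝ (Fin d) =>
        φ (x + WithLp.toLp 2 fun j => w (Sum.inl j)) * starRingEnd ℂ (ψ x))
          (-WithLp.toLp 2 fun j => w (Sum.inr j)) := by
  rw [L2.inner_def, Real.fourier_eq', ← integral_const_mul]
  refine integral_congr_ae ?_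
  filter_upwards [heisenberg_coeFn d w φ] with x hx
  rw [hx, RCLike.inner_apply, smul_eq_mul, ← mul_assoc, ← mul_assoc, ← Complex.exp_add]
  congr 3
  simp only [PiLp.inner_apply, PiLp.neg_apply, RCLike.inner_apply, conj_trivial]
  push_cast
  simp only [neg_mul, Finset.sum_neg_distrib]
  ring

theorem integrable_translate_mul_conj (d : ℕ) (ψ φ : L2Config d) (p : EuclideanSpace ℝ (Fin d)) :
    Integrable fun x => φ (x + p) * starRingEnd ℂ (ψ x) :=
  ((Lp.memLp φ).comp_measurePreserving (measurePreserving_add_right volume p)).integrable_mul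
    (Lp.memLp ψ).star

/-- A nonzero vector is determined up to a scalar by its diagonal matrix coefficients under the
Heisenberg operators: these determine the rank one kernel `(x, y) ↦ φ(y) φ̄(x)`. -/
theorem exists_smul_of_inner_heisenberg_eq (d : ℕ) (ψ φ : L2Config d) (hφ : φ ≠ 0)
    (h : ∀ w, inner ℂ ψ (heisenberg d w ψ) = inner ℂ φ (heisenberg d w φ)) :
    ∃ c : ℂ, ψ = c • φ := by
  have h1 : ∀ p : EuclideanSpace ℝ (Fin d), ∀ᵐ x,
      ψ (x + p) * starRingEnd ℂ (ψ x) = φ (x + p) * starRingEnd ℂ (φ x) := by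
    intro p
    have hF := ae_eq_zero_of_fourier_eq_zero
      ((integrable_translate_mul_conj d ψ ψ p).sub (integrable_translate_mul_conj d φ φ p))
      fun q => by
        have hw := h (Sum.elim (fun j => p j) (fun j => -q j))
        rw [inner_heisenberg, inner_heisenberg] at hw
        have hw' := mul_left_cancel₀ (Complex.exp_ne_zero _) hw
        have hq : (-WithLp.toLp 2 fun j => -q j) = q := by ext j; simp
        simp only [Sum.elim_inl, Sum.elim_inr, WithLp.toLp_ofLp, hq] at hw'
        rw [Real.fourier_eq] at hw' ⊢
        rw [Real.fourier_eq] at hw'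
        simp only [Pi.sub_apply, smul_sub]
        rw [integral_sub, hw', sub_self]
        · exact (Real.fourierIntegral_convergent_iff q).2 (integrable_translate_mul_conj d ψ ψ p)
        · exact (Real.fourierIntegral_convergent_iff q).2 (integrable_translate_mul_conj d φ φ p)
    filter_upwards [hF] with x hx
    exact sub_eq_zero.1 hx
  -- exchange the quantifiers, so that a single good base point `x` serves almost all `p`
  have h2 : ∀ᵐ x : EuclideanSpace ℝ (Fin d), ∀ᵐ p : EuclideanSpace ℝ (Fin d),
      ψ (x + p) * starRingEnd ℂ (ψ x) = φ (x + p) * starRingEnd ℂ (φ x) := by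
    refine (Measure.ae_ae_comm ?_).1 (ae_of_all _ h1)
    have m1 := (Lp.stronglyMeasurable ψ).measurable
    have m2 := (Lp.stronglyMeasurable φ).measurable
    have hc : Measurable (starRingEnd ℂ : ℂ → ℂ) := Complex.continuous_conj.measurable
    exact measurableSet_eq_fun (by fun_prop) (by fun_prop)
  obtain ⟨x, hx, hφx⟩ : ∃ x, (∀ᵐ p : EuclideanSpace ℝ (Fin d),
      ψ (x + p) * starRingEnd ℂ (ψ x) = φ (x + p) * starRingEnd ℂ (φ x)) ∧ φ x ≠ 0 := by
    by_contra! hcon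
    refine hφ (Lp.ext ?_)
    filter_upwards [h2, Lp.coeFn_zero ℂ 2 (volume : Measure (EuclideanSpace ℝ (Fin d)))]
      with x hx h0
    rw [hcon x hx, h0]
    rfl
  have hy : ∀ᵐ y, ψ y * starRingEnd ℂ (ψ x) = φ y * starRingEnd ℂ (φ x) := by
    filter_upwards [ae_comp_add_right hx (-x)] with y hy
    simpa using hy
  have hc : starRingEnd ℂ (φ x) ≠ 0 := by simpa using hφx
  have hψx : starRingEnd ℂ (ψ x) ≠ 0 := by
    intro h0
    refine hφ (Lp.ext ?_)
    filter_upwards [hy, Lp.coeFn_zero ℂ 2 (volume : Measure (EuclideanSpace ℝ (Fin d)))]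
      with y hy h0'
    rw [h0, mul_zero] at hy
    rw [h0']
    exact (mul_eq_zero.1 hy.symm).resolve_right hc
  refine ⟨starRingEnd ℂ (φ x) / starRingEnd ℂ (ψ x), Lp.ext ?_⟩
  filter_upwards [hy, Lp.coeFn_smul (starRingEnd ℂ (φ x) / starRingEnd ℂ (ψ x)) φ] with y hy hs
  rw [hs, Pi.smul_apply, smul_eq_mul, div_mul_eq_mul_div, eq_div_iff hψx, hy, mul_comm]

/-- The vacuum vector `2^{d/4} e^{-π x·x}`, whose Bargmann transform is the constant `1`. -/
noncomputable def vacuum (d : ℕ) : L2Config d := (memLp_bargmannKernel d 0).toLp _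

theorem vacuum_coeFn (d : ℕ) : vacuum d =ᵐ[volume] bargmannKernel d 0 := MemLp.coeFn_toLp _

theorem bargmannKernel_ne_zero (d : ℕ) (z : Fin d → ℂ) (x : EuclideanSpace ℝ (Fin d)) :
    bargmannKernel d z x ≠ 0 :=
  mul_ne_zero (by simpa using (Real.rpow_pos_of_pos two_pos _).ne') (Complex.exp_ne_zero _)

theorem vacuum_ne_zero (d : ℕ) : vacuum d ≠ 0 := by
  intro h
  have h1 := vacuum_coeFn d
  rw [h] at h1
  have h2 : ∀ᵐ _ : EuclideanSpace ℝ (Fin d), False := by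
    filter_upwards [h1, Lp.coeFn_zero ℂ 2 (volume : Measure (EuclideanSpace ℝ (Fin d)))]
      with x hx h0
    exact bargmannKernel_ne_zero d 0 x (hx.symm.trans h0)
  exact h2.exists.elim fun _ h => h

/-- The Bargmann transform is, up to a Gaussian factor, the coefficient of `f` along the coherent
states `ρ(-z) φ₀`, where `φ₀` is the vacuum. -/
theorem bargmannFun_eq_inner (d : ℕ) (f : L2Config d) (w : Fin d ⊕ Fin d → ℝ) :
    bargmannFun d f (fun j => -(⟨w (Sum.inl j), w (Sum.inr j)⟩ : ℂ)) =
      ((Real.exp (Real.pi / 2 * ∑ j, ‖(⟨w (Sum.inl j), w (Sum.inr j)⟩ : ℂ)‖ ^ 2) : ℝ) : ℂ) *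
        inner ℂ (heisenberg d w (vacuum d)) f := by
  rw [L2.inner_def, bargmannFun, ← integral_const_mul]
  refine integral_congr_ae ?_
  filter_upwards [heisenberg_coeFn d w (vacuum d),
    ae_comp_add_right (vacuum_coeFn d) (WithLp.toLp 2 fun j => w (Sum.inl j))] with x h1 h2
  rw [h1, h2, RCLike.inner_apply, mul_comm (f x), ← mul_assoc]
  congr 1
  simp only [bargmannKernel, map_mul, ← Complex.exp_conj, Complex.conj_ofReal, map_sub, map_sum,
    map_pow, Complex.conj_I, Complex.ofReal_exp, Pi.zero_apply, map_zero, mul_zero,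
    PiLp.add_apply, map_add, Complex.ofReal_add]
  simp only [mul_left_comm _ (((2 ^ ((d : ℝ) / 4) : ℝ) : ℂ)), ← Complex.exp_add]
  congr 2
  have hz : ∀ j, (⟨w (Sum.inl j), w (Sum.inr j)⟩ : ℂ) =
      w (Sum.inl j) + w (Sum.inr j) * Complex.I := fun j => by apply Complex.ext <;> simp
  simp only [Complex.sq_norm, Complex.normSq_mk]
  simp only [hz]
  push_cast
  simp only [Finset.mul_sum, Finset.sum_mul, ← Finset.sum_sub_distrib, ← Finset.sum_add_distrib]
  refine Finset.sum_congr rfl fun j _ => ?_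
  linear_combination (-(Real.pi : ℂ) / 2 * (w (Sum.inr j)) ^ 2) * Complex.I_sq

theorem eq_zero_of_bargmannFun_eq_zero (d : ℕ) (f : L2Config d)
    (h : bargmannFun d f = 0) : f = 0 := by
  have : bargmannIsometry d f = 0 :=
    (Lp.ext ((MemLp.coeFn_toLp (memLp_bargmannFun d (Lp.memLp f))).trans (by
      rw [h]; exact (Lp.coeFn_zero _ _ _).symm)))
  exact (map_eq_zero_iff _ (bargmannIsometry d).injective).1 this

/-- The coherent states `ρ(w) φ₀` span a dense subspace. -/
theorem topologicalClosure_span_coherent (d : ℕ) :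
    (Submodule.span ℂ (Set.range fun w => heisenberg d w (vacuum d))).topologicalClosure = ⊤ := by
  rw [Submodule.topologicalClosure_eq_top_iff, Submodule.eq_bot_iff]
  intro f hf
  refine eq_zero_of_bargmannFun_eq_zero d f (funext fun z => ?_)
  have h := bargmannFun_eq_inner d f (Sum.elim (fun j => -(z j).re) fun j => -(z j).im)
  have hz : (fun j => -(⟨-(z j).re, -(z j).im⟩ : ℂ)) = z := by
    ext j; apply Complex.ext <;> simp
  simp only [Sum.elim_inl, Sum.elim_inr, hz] at h
  rw [h, Submodule.mem_orthogonal _ _ |>.1 hf _ (Submodule.subset_span ⟨_, rfl⟩), mul_zero]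
  rfl

/-- Schur's lemma for the Heisenberg operators: two isometries that implement the same
transformation of the Heisenberg operators are proportional. -/
theorem exists_smul_of_intertwines (d : ℕ) (T : (Fin d ⊕ Fin d → ℝ) → Fin d ⊕ Fin d → ℝ)
    (hT : Function.Surjective T) (U W : L2Config d →ₗᵢ[ℂ] L2Config d)
    (hU : ∀ w f, U (heisenberg d w f) = heisenberg d (T w) (U f))
    (hW : ∀ w f, W (heisenberg d w f) = heisenberg d (T w) (W f)) :
    ∃ c : ℂ, ∀ f, U f = c • W f := by
  obtain ⟨c, hc⟩ := exists_smul_of_inner_heisenberg_eq d (U (vacuum d)) (W (vacuum d))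
    ((map_ne_zero_iff W W.injective).2 (vacuum_ne_zero d)) fun w => by
      obtain ⟨w, rfl⟩ := hT w
      rw [← hU, ← hW, LinearIsometry.inner_map_map, LinearIsometry.inner_map_map]
  refine ⟨c, fun f => ?_⟩
  have : U.toContinuousLinearMap = c • W.toContinuousLinearMap := by
    refine ContinuousLinearMap.ext_on (s := Set.range fun w => heisenberg d w (vacuum d)) ?_ ?_
    · rw [Submodule.dense_iff_topologicalClosure_eq_top]
      exact topologicalClosure_span_coherent d
    · rintro _ ⟨w, rfl⟩
      change U _ = c • W _
      rw [hU, hW, hc, heisenberg_smul]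
  exact DFunLike.congr_fun this f

/-! ### Polynomials in the range of the Bargmann transform -/

theorem bargmannFun_congr_ae (d : ℕ) {f g : EuclideanSpace ℝ (Fin d) → ℂ} (h : f =ᵐ[volume] g)
    (z : Fin d → ℂ) : bargmannFun d f z = bargmannFun d g z :=
  integral_congr_ae (by filter_upwards [h] with x hx; rw [hx])

theorem integral_euclidean_cexp_neg_sum_mul_sq_add (d : ℕ) {b : Fin d → ℂ}
    (hb : ∀ j, 0 < (b j).re) (c : Fin d → ℂ) :
    ∫ x : EuclideanSpace ℝ (Fin d), Complex.exp (-∑ j, b j * (x j : ℂ) ^ 2 + ∑ j, c j * x j) =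
      ∏ j, (Real.pi / b j) ^ (1 / 2 : ℂ) * Complex.exp (c j ^ 2 / (4 * b j)) := by
  rw [← GaussianFourier.integral_cexp_neg_sum_mul_add hb c]
  exact (EuclideanSpace.volume_preserving_symm_measurableEquiv_toLp (Fin d)).integral_comp'
    (g := fun v : Fin d → ℝ => Complex.exp (-∑ j, b j * (v j : ℂ) ^ 2 + ∑ j, c j * v j))

theorem bargmannFun_bargmannKernel_zero (d : ℕ) (z : Fin d → ℂ) :
    bargmannFun d (bargmannKernel d 0) z = 1 := by
  have h1 : ∀ x : EuclideanSpace ℝ (Fin d), bargmannKernel d z x * bargmannKernel d 0 x =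
      (((2 ^ ((d : ℝ) / 4) : ℝ) : ℂ) ^ 2 * Complex.exp (-(Real.pi / 2 * ∑ j, z j ^ 2))) *
        Complex.exp (-∑ j, (2 * Real.pi : ℂ) * (x j : ℂ) ^ 2 +
          ∑ j, (2 * Real.pi * z j) * (x j : ℂ)) := by
    intro x
    simp only [bargmannKernel]
    rw [mul_assoc (_ ^ 2), ← Complex.exp_add, mul_mul_mul_comm, ← Complex.exp_add, pow_two]
    congr 2
    simp only [← Finset.mul_sum, mul_assoc, Pi.zero_apply, mul_comm (z _)]
    simp
    ring
  have hpi : (Real.pi : ℂ) ≠ 0 := by exact_mod_cast Real.pi_ne_zero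
  rw [bargmannFun]
  simp only [h1]
  rw [integral_const_mul, integral_euclidean_cexp_neg_sum_mul_sq_add d (b := fun _ => 2 * Real.pi)
    (by simp [Real.pi_pos]), Finset.prod_mul_distrib, ← Complex.exp_sum, Finset.prod_const]
  have h2 : ∑ j, (2 * Real.pi * z j) ^ 2 / (4 * (2 * Real.pi)) =
      (Real.pi / 2 * ∑ j, z j ^ 2 : ℂ) := by
    rw [Finset.mul_sum]
    refine Finset.sum_congr rfl fun j _ => ?_
    field_simp
    ring
  have h3 : ((2 ^ ((d : ℝ) / 4) : ℝ) : ℂ) ^ 2 *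
      ((Real.pi / (2 * Real.pi) : ℂ) ^ (1 / 2 : ℂ)) ^ (Finset.univ : Finset (Fin d)).card = 1 := by
    have h4 : (Real.pi / (2 * Real.pi) : ℂ) ^ (1 / 2 : ℂ) = (((1 / 2 : ℝ) ^ (1 / 2 : ℝ) : ℝ) : ℂ) := by
      rw [Complex.ofReal_cpow (by norm_num)]
      congr 1
      · push_cast; field_simp
      · push_cast; rfl
    rw [h4, Finset.card_univ, Fintype.card_fin]
    norm_cast
    rw [← Real.rpow_mul_natCast (by norm_num), ← Real.rpow_mul_natCast (by norm_num),
      one_div, Real.inv_rpow (by norm_num), ← Real.rpow_neg (by norm_num),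
      ← Real.rpow_add (by norm_num)]
    rw [show (d : ℝ) / 4 * (2 : ℕ) + -(2⁻¹ * d) = 0 by push_cast; ring, Real.rpow_zero]
  rw [h2, mul_mul_mul_comm, h3, ← Complex.exp_add, neg_add_cancel, Complex.exp_zero, one_mul]

theorem bargmannFun_vacuum (d : ℕ) (z : Fin d → ℂ) : bargmannFun d (vacuum d) z = 1 :=
  (bargmannFun_congr_ae d (vacuum_coeFn d) z).trans (bargmannFun_bargmannKernel_zero d z)

theorem inner_heisenberg_vacuum (d : ℕ) (w : Fin d ⊕ Fin d → ℝ) :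
    inner ℂ (heisenberg d w (vacuum d)) (vacuum d) =
      ((Real.exp (-(Real.pi / 2 * ∑ j, ‖(⟨w (Sum.inl j), w (Sum.inr j)⟩ : ℂ)‖ ^ 2)) : ℝ) : ℂ) := by
  have h := bargmannFun_eq_inner d (vacuum d) w
  rw [bargmannFun_vacuum] at h
  rw [Real.exp_neg, Complex.ofReal_inv]
  exact (inv_eq_of_mul_eq_one_right h.symm).symm

/-- The value of a polynomial with complex coefficients at a point of `ℝ^d`. -/
noncomputable def realEval (d : ℕ) (x : EuclideanSpace ℝ (Fin d)) : MvPolynomial (Fin d) ℂ →+* ℂ :=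
  MvPolynomial.eval fun j => (x j : ℂ)

theorem continuous_realEval (d : ℕ) (P : MvPolynomial (Fin d) ℂ) :
    Continuous fun x => realEval d x P :=
  (MvPolynomial.continuous_eval P).comp (by fun_prop)

/-- Polynomials grow more slowly than every Gaussian `e^{ε|x|²}`. -/
theorem exists_norm_realEval_le (d : ℕ) (P : MvPolynomial (Fin d) ℂ) :
    ∀ ε : ℝ, 0 < ε → ∃ C : ℝ, 0 ≤ C ∧ ∀ x, ‖realEval d x P‖ ≤ C * Real.exp (ε * ‖x‖ ^ 2) := by
  induction P using MvPolynomial.induction_on with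
  | C a =>
    intro ε hε
    refine ⟨‖a‖, norm_nonneg _, fun x => ?_⟩
    simp only [realEval, MvPolynomial.eval_C]
    exact le_mul_of_one_le_right (norm_nonneg _) (Real.one_le_exp (by positivity))
  | add p q hp hq =>
    intro ε hε
    obtain ⟨C, hC, h⟩ := hp ε hε
    obtain ⟨D, hD, h'⟩ := hq ε hε
    refine ⟨C + D, add_nonneg hC hD, fun x => ?_⟩
    rw [map_add, add_mul]
    exact (norm_add_le _ _).trans (add_le_add (h x) (h' x))
  | mul_X p j hp =>
    intro ε hε
    obtain ⟨C, hC, h⟩ := hp (ε / 2) (by positivity)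
    refine ⟨C * (1 + 1 / ε), by positivity, fun x => ?_⟩
    have hX : ‖realEval d x (MvPolynomial.X j)‖ ≤ (1 + 1 / ε) * Real.exp (ε / 2 * ‖x‖ ^ 2) := by
      simp only [realEval, MvPolynomial.eval_X, Complex.norm_real]
      refine (PiLp.norm_apply_le x j).trans ?_
      have h1 := Real.add_one_le_exp (ε / 2 * ‖x‖ ^ 2)
      have h2 : ‖x‖ ≤ (1 + 1 / ε) * (ε / 2 * ‖x‖ ^ 2 + 1) := by
        have : (1 + 1 / ε) * (ε / 2 * ‖x‖ ^ 2 + 1) =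
          ε / 2 * ‖x‖ ^ 2 + 1 + ‖x‖ ^ 2 / 2 + 1 / ε := by field_simp; ring
        rw [this]
        have : 0 < 1 / ε := by positivity
        have : 0 ≤ ε / 2 * ‖x‖ ^ 2 := by positivity
        nlinarith [sq_nonneg (‖x‖ - 1)]
      exact h2.trans (mul_le_mul_of_nonneg_left h1 (by positivity))
    rw [map_mul, norm_mul]
    refine (mul_le_mul (h x) hX (norm_nonneg _) (by positivity)).trans (le_of_eq ?_)
    rw [mul_mul_mul_comm, ← Real.exp_add]
    ring_nf

/-- The function `P(x) 2^{d/4} e^{-π x·x}` on `ℝ^d`. -/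
noncomputable def polyGauss (d : ℕ) (P : MvPolynomial (Fin d) ℂ) (x : EuclideanSpace ℝ (Fin d)) : ℂ :=
  realEval d x P * bargmannKernel d 0 x

theorem memLp_polyGauss (d : ℕ) (P : MvPolynomial (Fin d) ℂ) : MemLp (polyGauss d P) 2 volume := by
  obtain ⟨C, hC, h⟩ := exists_norm_realEval_le d P (Real.pi / 2) (by positivity)
  refine ((memLp_gauss d (by positivity : 0 < Real.pi / 2) 0).const_mul
    (C * 2 ^ ((d : ℝ) / 4))).of_le
    ((continuous_realEval d P).mul (continuous_bargmannKernel d 0)).aestronglyMeasurable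
    (ae_of_all _ fun x => ?_)
  rw [polyGauss, norm_mul, norm_bargmannKernel]
  refine (mul_le_mul_of_nonneg_right (h x) (by positivity)).trans ((le_of_eq ?_).trans
    (le_abs_self _))
  have h0 : inner ℝ ((2 * Real.pi) • WithLp.toLp 2 fun j : Fin d => ((0 : Fin d → ℂ) j).re) x = 0 := by
    simp [PiLp.inner_apply]
  rw [h0]
  simp only [Pi.zero_apply, inner_zero_left, add_zero, ne_eq, OfNat.ofNat_ne_zero,
    not_false_eq_true, zero_pow, Finset.sum_const_zero, Complex.zero_re, mul_zero, Real.exp_zero,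
    mul_one]
  rw [mul_mul_mul_comm, ← Real.exp_add]
  ring_nf

theorem hasLineDerivAt_realEval (d : ℕ) (P : MvPolynomial (Fin d) ℂ) (j : Fin d)
    (x : EuclideanSpace ℝ (Fin d)) :
    HasLineDerivAt ℝ (fun x => realEval d x P) (realEval d x (MvPolynomial.pderiv j P)) x
      (EuclideanSpace.single j 1) := by
  unfold HasLineDerivAt
  induction P using MvPolynomial.induction_on with
  | C a => simpa [realEval] using hasDerivAt_const (0 : ℝ) a
  | add p q hp hq => simpa only [map_add] using hp.fun_add hq
  | mul_X p i hp =>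
    have hX : HasDerivAt (fun t : ℝ => realEval d (x + t • EuclideanSpace.single j 1)
        (MvPolynomial.X i)) (realEval d x (MvPolynomial.pderiv j (MvPolynomial.X i))) 0 := by
      have h1 : HasDerivAt (fun t : ℝ => x i + t * (if i = j then 1 else 0))
          (if i = j then 1 else 0) 0 := by
        simpa using ((hasDerivAt_id (0 : ℝ)).mul_const (if i = j then (1 : ℝ) else 0)).const_add (x i)
      have h2 := h1.ofReal_comp
      rw [MvPolynomial.pderiv_X]
      convert h2 using 1
      · ext t; simp [realEval]
      · by_cases hij : i = j
        · subst hij; simp [realEval]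
        · simp [realEval, hij]
    simp only [map_mul, Derivation.leibniz, smul_eq_mul, map_add]
    refine (hp.fun_mul hX).congr_deriv ?_
    simp only [zero_smul, add_zero]
    ring

theorem hasLineDerivAt_bargmannKernel (d : ℕ) (z : Fin d → ℂ) (j : Fin d)
    (x : EuclideanSpace ℝ (Fin d)) :
    HasLineDerivAt ℝ (bargmannKernel d z) (2 * Real.pi * (z j - x j) * bargmannKernel d z x) x
      (EuclideanSpace.single j 1) := by
  unfold HasLineDerivAt bargmannKernel
  have hx : ∀ i, HasDerivAt (fun t : ℝ => (((x + t • EuclideanSpace.single j (1 : ℝ)) i : ℝ) : ℂ))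
      (if i = j then 1 else 0) 0 := fun i => by
    have h1 := (((hasDerivAt_id (0 : ℝ)).mul_const (if i = j then (1 : ℝ) else 0)).const_add
      (x i)).ofReal_comp
    convert h1 using 1
    · ext t; simp
    · split_ifs <;> simp
  have h1 := HasDerivAt.fun_sum (u := Finset.univ) fun i _ => (hx i).mul_const (z i)
  have h2 := HasDerivAt.fun_sum (u := Finset.univ) fun i _ => (hx i).fun_pow 2
  have h3 := ((((h1.const_mul (2 * Real.pi : ℂ)).fun_sub (h2.const_mul (Real.pi : ℂ))).sub_const
    (Real.pi / 2 * ∑ j, z j ^ 2)).cexp).const_mul (((2 ^ ((d : ℝ) / 4) : ℝ) : ℂ))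
  refine h3.congr_deriv ?_
  simp
  ring

theorem bargmannFun_polyGauss_add (d : ℕ) (P Q : MvPolynomial (Fin d) ℂ) (z : Fin d → ℂ) :
    bargmannFun d (polyGauss d (P + Q)) z =
      bargmannFun d (polyGauss d P) z + bargmannFun d (polyGauss d Q) z := by
  rw [bargmannFun, bargmannFun, bargmannFun, ← integral_add
    (integrable_bargmann d (memLp_polyGauss d P) z) (integrable_bargmann d (memLp_polyGauss d Q) z)]
  simp only [polyGauss, map_add, add_mul, mul_add]

theorem bargmannFun_polyGauss_C_mul (d : ℕ) (a : ℂ) (P : MvPolynomial (Fin d) ℂ) (z : Fin d → ℂ) :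
    bargmannFun d (polyGauss d (MvPolynomial.C a * P)) z = a * bargmannFun d (polyGauss d P) z := by
  rw [bargmannFun, bargmannFun, ← integral_const_mul]
  simp only [polyGauss, map_mul, realEval, MvPolynomial.eval_C, mul_left_comm _ a, mul_assoc]

/-- The Bargmann transform carries the creation operator `x_j - (2π)⁻¹ ∂_j`, written on
`P(x) e^{-π x·x}` as a transformation of `P`, to multiplication by `z_j`. -/
theorem bargmannFun_creation (d : ℕ) (P : MvPolynomial (Fin d) ℂ) (j : Fin d) (z : Fin d → ℂ) :
    bargmannFun d (polyGauss d (MvPolynomial.C 2 * (MvPolynomial.X j * P) +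
        MvPolynomial.C (-(2 * Real.pi : ℂ)⁻¹) * MvPolynomial.pderiv j P)) z =
      z j * bargmannFun d (polyGauss d P) z := by
  have hpi : (Real.pi : ℂ) ≠ 0 := by exact_mod_cast Real.pi_ne_zero
  have hint := fun Q => integrable_bargmann d (memLp_polyGauss d Q) z
  -- `D` and `D'` are the polynomial factors of `K ∂_j (P φ₀)` and `(∂_j K) P φ₀` for the kernel `K`
  let D : MvPolynomial (Fin d) ℂ := MvPolynomial.pderiv j P +
    MvPolynomial.C (-(2 * Real.pi : ℂ)) * (MvPolynomial.X j * P)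
  let D' : MvPolynomial (Fin d) ℂ := MvPolynomial.C (2 * Real.pi * z j : ℂ) * P +
    MvPolynomial.C (-(2 * Real.pi : ℂ)) * (MvPolynomial.X j * P)
  have key := integral_bilinear_hasLineDerivAt_right_eq_neg_left_of_integrable
    (μ := (volume : Measure (EuclideanSpace ℝ (Fin d)))) (B := ContinuousLinearMap.mul ℝ ℂ)
    (f := bargmannKernel d z) (g := polyGauss d P)
    (f' := fun x => 2 * Real.pi * (z j - x j) * bargmannKernel d z x) (g' := polyGauss d D)
    (v := EuclideanSpace.single j 1) ?_ ?_ ?_ ?_ ?_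
  · have e1 : ∫ x, 2 * Real.pi * (z j - x j) * bargmannKernel d z x * polyGauss d P x =
        bargmannFun d (polyGauss d D') z := by
      refine integral_congr_ae (ae_of_all _ fun x => ?_)
      simp [D', polyGauss, realEval]
      ring
    have e2 : bargmannFun d (polyGauss d D) z = - bargmannFun d (polyGauss d D') z := by
      rw [← e1]
      exact key
    simp only [D, D', bargmannFun_polyGauss_add, bargmannFun_polyGauss_C_mul] at e2 ⊢
    field_simp
    linear_combination -e2
  · refine (hint D').congr (ae_of_all _ fun x => ?_)
    simp [D', polyGauss, realEval]
    ring
  · exact hint D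
  · exact hint P
  · exact fun x _ => hasLineDerivAt_bargmannKernel d z j x
  · intro x _
    have h1 := hasLineDerivAt_realEval d P j x
    have h2 := hasLineDerivAt_bargmannKernel d 0 j x
    unfold HasLineDerivAt at h1 h2 ⊢
    refine (h1.fun_mul h2).congr_deriv ?_
    simp [D, polyGauss, realEval]
    ring

/-- Every polynomial is a Bargmann transform: start from `1` and apply creation operators. -/
theorem exists_bargmannFun_eq_eval (d : ℕ) (q : MvPolynomial (Fin d) ℂ) :
    ∃ P : MvPolynomial (Fin d) ℂ, ∀ z, bargmannFun d (polyGauss d P) z = MvPolynomial.eval z q := by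
  induction q using MvPolynomial.induction_on with
  | C a =>
    refine ⟨MvPolynomial.C a * 1, fun z => ?_⟩
    have : polyGauss d 1 = bargmannKernel d 0 := by ext x; simp [polyGauss]
    rw [bargmannFun_polyGauss_C_mul, this, bargmannFun_bargmannKernel_zero]
    simp
  | add p q hp hq =>
    obtain ⟨P, hP⟩ := hp
    obtain ⟨Q, hQ⟩ := hq
    exact ⟨P + Q, fun z => by rw [bargmannFun_polyGauss_add, hP, hQ, map_add]⟩
  | mul_X p j hp =>
    obtain ⟨P, hP⟩ := hp
    exact ⟨_, fun z => by
      rw [bargmannFun_creation d P j z, hP, map_mul, MvPolynomial.eval_X, mul_comm]⟩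

/-- The adjoint of the isometry `B̂` inverts it on its range, which contains the polynomials. -/
theorem bargmannFun_of_bargmannAdjoint_fockPolynomial (d : ℕ) (q : MvPolynomial (Fin d) ℂ)
    (z : Fin d → ℂ) :
    bargmannFun d (bargmannAdjoint d (fockPolynomial d q)) z = MvPolynomial.eval z q := by
  obtain ⟨P, hP⟩ := exists_bargmannFun_eq_eval d q
  set f : L2Config d := (memLp_polyGauss d P).toLp _ with hf
  have hB : ∀ z, bargmannFun d f z = MvPolynomial.eval z q := fun z =>
    (bargmannFun_congr_ae d (MemLp.coeFn_toLp _) z).trans (hP z)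
  have h1 : bargmannIsometry d f = (fockPolynomial d q : Lp ℂ 2 (fockMeasure d)) :=
    MemLp.toLp_congr (memLp_bargmannFun d (Lp.memLp f)) (memLp_polynomial d q) (ae_of_all _ hB)
  have h2 : bargmannAdjoint d (fockPolynomial d q) = f := by
    change ContinuousLinearMap.adjoint (bargmannIsometry d).toContinuousLinearMap
      (fockPolynomial d q : Lp ℂ 2 (fockMeasure d)) = f
    rw [← h1]
    refine ext_inner_right ℂ fun g => ?_
    rw [ContinuousLinearMap.adjoint_inner_left]
    exact (bargmannIsometry d).inner_map_map f g
  rw [h2, hB]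

/-! ### The metaplectic operators of unitary matrices on the Fock space -/

theorem sum_norm_sq_mulVec_unitary (d : ℕ) (g : Matrix.unitaryGroup (Fin d) ℂ) (z : Fin d → ℂ) :
    ∑ j, ‖Matrix.mulVec (g : Matrix (Fin d) (Fin d) ℂ) z j‖ ^ 2 = ∑ j, ‖z j‖ ^ 2 := by
  have h : ∀ v : Fin d → ℂ, ((∑ j, ‖v j‖ ^ 2 : ℝ) : ℂ) = star v ⬝ᵥ v := fun v => by
    simp [dotProduct, Complex.conj_mul']
  have hg := (Matrix.mem_unitaryGroup_iff').1 g.2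
  rw [Matrix.star_eq_conjTranspose] at hg
  have h1 := h (Matrix.mulVec (g : Matrix (Fin d) (Fin d) ℂ) z)
  rw [Matrix.star_mulVec, ← Matrix.dotProduct_mulVec, Matrix.mulVec_mulVec, hg, Matrix.one_mulVec,
    ← h] at h1
  exact_mod_cast h1

theorem heisenberg_inner_vacuum_unitary (d : ℕ) (g : Matrix.unitaryGroup (Fin d) ℂ)
    (w : Fin d ⊕ Fin d → ℝ) :
    inner ℂ (heisenberg d (Matrix.mulVec
      (unitaryToSymplectic d g : Matrix (Fin d ⊕ Fin d) (Fin d ⊕ Fin d) ℝ) w) (vacuum d)) (vacuum d) =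
      inner ℂ (heisenberg d w (vacuum d)) (vacuum d) := by
  rw [inner_heisenberg_vacuum, inner_heisenberg_vacuum]
  simp only [unitaryToSymplectic_mulVec, sum_norm_sq_mulVec_unitary]

theorem symplectic_mulVec_surjective (d : ℕ) (S : Matrix.symplecticGroup (Fin d) ℝ) :
    Function.Surjective
      (Matrix.mulVec (S : Matrix (Fin d ⊕ Fin d) (Fin d ⊕ Fin d) ℝ)) := fun w =>
  ⟨Matrix.mulVec ((S⁻¹ : Matrix.symplecticGroup (Fin d) ℝ) : Matrix _ _ ℝ) w, by
    rw [Matrix.mulVec_mulVec, ← Submonoid.coe_mul, mul_inv_cancel, Submonoid.coe_one,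
      Matrix.one_mulVec]⟩

section

variable {d : ℕ} {μ : Matrix.symplecticGroup (Fin d) ℝ → (L2Config d ≃ₗᵢ[ℂ] L2Config d)}

/-- The vacuum is an eigenvector of the metaplectic operators of unitary matrices, because its
diagonal matrix coefficient `e^{-π|w|²/2}` is invariant under unitary matrices. -/
theorem IsMetaplectic.exists_vacuum_eigenvalue (hμ : IsMetaplectic d μ)
    (g : Matrix.unitaryGroup (Fin d) ℂ) :
    ∃ c : ℂ, μ (unitaryToSymplectic d g) (vacuum d) = c • vacuum d := by
  refine exists_smul_of_inner_heisenberg_eq d _ _ (vacuum_ne_zero d) fun w => ?_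
  obtain ⟨w, rfl⟩ := symplectic_mulVec_surjective d (unitaryToSymplectic d g) w
  rw [← hμ.intertwines, LinearIsometryEquiv.inner_map_map, ← inner_conj_symm,
    ← heisenberg_inner_vacuum_unitary d g w, inner_conj_symm]

/-- The eigenvalue of the metaplectic operator of a unitary matrix on the vacuum. -/
noncomputable def IsMetaplectic.vacuumEigenvalue (hμ : IsMetaplectic d μ)
    (g : Matrix.unitaryGroup (Fin d) ℂ) : ℂ := (hμ.exists_vacuum_eigenvalue g).choose

theorem IsMetaplectic.apply_vacuum (hμ : IsMetaplectic d μ) (g : Matrix.unitaryGroup (Fin d) ℂ) :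
    μ (unitaryToSymplectic d g) (vacuum d) = hμ.vacuumEigenvalue g • vacuum d :=
  (hμ.exists_vacuum_eigenvalue g).choose_spec

theorem IsMetaplectic.norm_vacuumEigenvalue (hμ : IsMetaplectic d μ)
    (g : Matrix.unitaryGroup (Fin d) ℂ) : ‖hμ.vacuumEigenvalue g‖ = 1 := by
  have h := congrArg norm (hμ.apply_vacuum g)
  rw [LinearIsometryEquiv.norm_map, norm_smul] at h
  exact mul_right_cancel₀ (norm_ne_zero_iff.2 (vacuum_ne_zero d)) (by rw [← h, one_mul])

/-- On the Fock space, the metaplectic operator of a unitary matrix `g` is the substitution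
`z ↦ g⁻¹ z` followed by multiplication by the vacuum eigenvalue. -/
theorem IsMetaplectic.bargmannFun_apply (hμ : IsMetaplectic d μ)
    (g : Matrix.unitaryGroup (Fin d) ℂ) (f : L2Config d) (z : Fin d → ℂ) :
    bargmannFun d (μ (unitaryToSymplectic d g) f)
        (Matrix.mulVec (g : Matrix (Fin d) (Fin d) ℂ) z) =
      hμ.vacuumEigenvalue g * bargmannFun d f z := by
  set c := hμ.vacuumEigenvalue g with hc
  have hcc : c * starRingEnd ℂ c = 1 := by
    rw [Complex.mul_conj', hμ.norm_vacuumEigenvalue]; simp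
  let w : Fin d ⊕ Fin d → ℝ := Sum.elim (fun j => -(z j).re) fun j => -(z j).im
  have hw : (fun j => (⟨w (Sum.inl j), w (Sum.inr j)⟩ : ℂ)) = -z := by
    ext j; apply Complex.ext <;> simp [w]
  have hz : z = fun j => -(⟨w (Sum.inl j), w (Sum.inr j)⟩ : ℂ) := by
    rw [eq_comm]; ext j; rw [congrFun hw j]; simp
  have hgz : Matrix.mulVec (g : Matrix (Fin d) (Fin d) ℂ) z = fun j =>
      -(⟨Matrix.mulVec (unitaryToSymplectic d g : Matrix (Fin d ⊕ Fin d) (Fin d ⊕ Fin d) ℝ) w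
        (Sum.inl j), Matrix.mulVec
        (unitaryToSymplectic d g : Matrix (Fin d ⊕ Fin d) (Fin d ⊕ Fin d) ℝ) w (Sum.inr j)⟩ : ℂ) := by
    ext j
    rw [unitaryToSymplectic_mulVec, hw, Matrix.mulVec_neg, Pi.neg_apply, neg_neg]
  rw [hgz, bargmannFun_eq_inner]
  conv_rhs => rw [hz, bargmannFun_eq_inner]
  simp only [unitaryToSymplectic_mulVec, sum_norm_sq_mulVec_unitary]
  rw [mul_left_comm]
  congr 1
  have h1 : inner ℂ (heisenberg d w (vacuum d)) f = starRingEnd ℂ c * inner ℂ (heisenberg d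
      (Matrix.mulVec (unitaryToSymplectic d g : Matrix (Fin d ⊕ Fin d) (Fin d ⊕ Fin d) ℝ) w)
      (vacuum d)) (μ (unitaryToSymplectic d g) f) := by
    rw [← LinearIsometryEquiv.inner_map_map (μ (unitaryToSymplectic d g)), hμ.intertwines,
      hμ.apply_vacuum, heisenberg_smul, inner_smul_left]
  rw [h1, ← mul_assoc, hcc, one_mul]

theorem IsMetaplectic.fockOperator_fockPolynomial (hμ : IsMetaplectic d μ)
    (g : Matrix.unitaryGroup (Fin d) ℂ) (p q : MvPolynomial (Fin d) ℂ)
    (hpq : ∀ z, MvPolynomial.eval (Matrix.mulVec (g : Matrix (Fin d) (Fin d) ℂ) z) q =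
      MvPolynomial.eval z p) :
    fockOperator d (μ (unitaryToSymplectic d g)) (fockPolynomial d p) =
      hμ.vacuumEigenvalue g • fockPolynomial d q := by
  rw [← map_smul]
  refine Subtype.ext (MemLp.toLp_congr
    (memLp_bargmannFun d (Lp.memLp (μ (unitaryToSymplectic d g)
      (bargmannAdjoint d (fockPolynomial d p)))))
    (memLp_polynomial d _) (ae_of_all _ fun z => ?_))
  have hz : z = Matrix.mulVec (g : Matrix (Fin d) (Fin d) ℂ)
      (Matrix.mulVec (star (g : Matrix (Fin d) (Fin d) ℂ)) z) := by
    rw [Matrix.mulVec_mulVec, (Matrix.mem_unitaryGroup_iff).1 g.2, Matrix.one_mulVec]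
  rw [hz, hμ.bargmannFun_apply, bargmannFun_of_bargmannAdjoint_fockPolynomial]
  beta_reduce
  rw [MvPolynomial.smul_eval, hpq]

theorem eval_linearPolynomial (d : ℕ) (v z : Fin d → ℂ) :
    MvPolynomial.eval z (linearPolynomial d v) = v ⬝ᵥ z := by
  simp [linearPolynomial, Fintype.linearCombination_apply, dotProduct]

theorem IsMetaplectic.fockOperator_symmetric (hμ : IsMetaplectic d μ)
    (g : Matrix.unitaryGroup (Fin d) ℂ) (k : ℕ) (v : Fin k → Fin d → ℂ) :
    fockOperator d (μ (unitaryToSymplectic d g))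
        (fockPolynomial d (symmetricToPolynomial d k (SymmetricPower.tprod ℂ v))) =
      hμ.vacuumEigenvalue g • fockPolynomial d (symmetricToPolynomial d k
        (SymmetricPower.tprod ℂ fun i =>
          Matrix.mulVec ((g : Matrix (Fin d) (Fin d) ℂ).map (starRingEnd ℂ)) (v i))) := by
  refine hμ.fockOperator_fockPolynomial g _ _ fun z => ?_
  rw [symmetricToPolynomial, symmetricPowerLift_tprod, symmetricPowerLift_tprod]
  simp only [MultilinearMap.compLinearMap_apply, MultilinearMap.mkPiAlgebra_apply, map_prod,
    eval_linearPolynomial]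
  refine Finset.prod_congr rfl fun i _ => ?_
  have h1 : (g : Matrix (Fin d) (Fin d) ℂ).map (starRingEnd ℂ) =
      (star (g : Matrix (Fin d) (Fin d) ℂ)).transpose := rfl
  rw [h1, Matrix.mulVec_transpose, ← Matrix.dotProduct_mulVec, Matrix.mulVec_mulVec,
    (Matrix.mem_unitaryGroup_iff').1 g.2, Matrix.one_mulVec]

theorem IsMetaplectic.fockOperator_mem_fockHomogeneous (hμ : IsMetaplectic d μ)
    (g : Matrix.unitaryGroup (Fin d) ℂ) (k : ℕ) (F : fockSpace d) (hF : F ∈ fockHomogeneous d k) :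
    fockOperator d (μ (unitaryToSymplectic d g)) F ∈ fockHomogeneous d k := by
  rw [← range_symmetricToFock] at hF ⊢
  obtain ⟨s, rfl⟩ := hF
  have hs : s ∈ Submodule.span ℂ (Set.range
      (SymmetricPower.tprod ℂ (ι := Fin k) (M := Fin d → ℂ))) := by
    rw [SymmetricPower.span_tprod_eq_top]; trivial
  induction hs using Submodule.span_induction with
  | mem x hx =>
    obtain ⟨v, rfl⟩ := hx
    exact ⟨hμ.vacuumEigenvalue g • SymmetricPower.tprod ℂ fun i =>
        Matrix.mulVec ((g : Matrix (Fin d) (Fin d) ℂ).map (starRingEnd ℂ)) (v i), by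
      rw [map_smul]
      exact (hμ.fockOperator_symmetric g k v).symm⟩
  | zero => rw [map_zero, map_zero]; exact Submodule.zero_mem _
  | add x y _ _ hx hy => rw [map_add, map_add]; exact Submodule.add_mem _ hx hy
  | smul a x _ hx => rw [map_smul, map_smul]; exact Submodule.smul_mem _ _ hx

theorem IsMetaplectic.transportToSymmetric_tprod (hμ : IsMetaplectic d μ)
    (g : Matrix.unitaryGroup (Fin d) ℂ) (k : ℕ)
    (hinv : ∀ F ∈ fockHomogeneous d k,
      fockOperator d (μ (unitaryToSymplectic d g)) F ∈ fockHomogeneous d k)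
    (v : Fin k → Fin d → ℂ) :
    transportToSymmetric d k (fockOperator d (μ (unitaryToSymplectic d g))) hinv
        (SymmetricPower.tprod ℂ v) =
      hμ.vacuumEigenvalue g • SymmetricPower.tprod ℂ fun i =>
        Matrix.mulVec ((g : Matrix (Fin d) (Fin d) ℂ).map (starRingEnd ℂ)) (v i) := by
  change (symmetricToFock d k).symm _ = _
  rw [LinearEquiv.symm_apply_eq, map_smul]
  exact Subtype.ext (hμ.fockOperator_symmetric g k v)

end

/-! ### The square of the vacuum eigenvalue as a character of the unitary group -/

theorem unitaryToSymplectic_mul (d : ℕ) (g h : Matrix.unitaryGroup (Fin d) ℂ) :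
    unitaryToSymplectic d (g * h) = unitaryToSymplectic d g * unitaryToSymplectic d h := by
  refine Subtype.ext ?_
  rw [Submonoid.coe_mul]
  simp only [unitaryToSymplectic]
  rw [Matrix.fromBlocks_multiply]
  congr 1 <;> ext i j <;>
    simp [Matrix.mul_apply, Finset.sum_add_distrib, sub_eq_add_neg, add_comm]

section

variable {d : ℕ} {μ : Matrix.symplecticGroup (Fin d) ℝ → (L2Config d ≃ₗᵢ[ℂ] L2Config d)}

theorem IsMetaplectic.vacuumEigenvalue_ne_zero (hμ : IsMetaplectic d μ)
    (g : Matrix.unitaryGroup (Fin d) ℂ) : hμ.vacuumEigenvalue g ≠ 0 := by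
  rw [← norm_ne_zero_iff, hμ.norm_vacuumEigenvalue]
  exact one_ne_zero

/-- Squaring removes the sign ambiguity of the metaplectic representation. -/
theorem IsMetaplectic.vacuumEigenvalue_mul_sq (hμ : IsMetaplectic d μ)
    (g h : Matrix.unitaryGroup (Fin d) ℂ) :
    hμ.vacuumEigenvalue (g * h) ^ 2 = hμ.vacuumEigenvalue g ^ 2 * hμ.vacuumEigenvalue h ^ 2 := by
  have h0 := hμ.apply_vacuum (g * h)
  have key : ∀ a : ℂ, a • vacuum d =
      (hμ.vacuumEigenvalue g * hμ.vacuumEigenvalue h) • vacuum d →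
      a = hμ.vacuumEigenvalue g * hμ.vacuumEigenvalue h := fun a ha =>
    smul_left_injective ℂ (vacuum_ne_zero d) ha
  have h1 : μ (unitaryToSymplectic d g) (μ (unitaryToSymplectic d h) (vacuum d)) =
      (hμ.vacuumEigenvalue g * hμ.vacuumEigenvalue h) • vacuum d := by
    rw [hμ.apply_vacuum, map_smul, hμ.apply_vacuum, smul_smul, mul_comm]
  rw [unitaryToSymplectic_mul] at h0
  rcases hμ.mul_up_to_sign (unitaryToSymplectic d g) (unitaryToSymplectic d h) with hs | hs
  · rw [hs, h1] at h0
    rw [key _ h0.symm, mul_pow]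
  · rw [hs, h1] at h0
    have := key (-hμ.vacuumEigenvalue (g * h)) (by rw [neg_smul, ← h0, neg_neg])
    rw [← neg_sq, this, mul_pow]

/-- The character `g ↦ c(g)²` of the unitary group, where `c(g)` is the vacuum eigenvalue. -/
noncomputable def IsMetaplectic.vacuumCharacter (hμ : IsMetaplectic d μ) :
    Matrix.unitaryGroup (Fin d) ℂ →* ℂ :=
  (Units.coeHom ℂ).comp (MonoidHom.mk'
    (fun g => Units.mk0 (hμ.vacuumEigenvalue g ^ 2) (pow_ne_zero 2 (hμ.vacuumEigenvalue_ne_zero g)))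
    fun g h => Units.ext (hμ.vacuumEigenvalue_mul_sq g h))

theorem IsMetaplectic.vacuumCharacter_apply (hμ : IsMetaplectic d μ)
    (g : Matrix.unitaryGroup (Fin d) ℂ) : hμ.vacuumCharacter g = hμ.vacuumEigenvalue g ^ 2 := rfl

theorem IsMetaplectic.vacuumCharacter_ne_zero (hμ : IsMetaplectic d μ)
    (g : Matrix.unitaryGroup (Fin d) ℂ) : hμ.vacuumCharacter g ≠ 0 :=
  pow_ne_zero 2 (hμ.vacuumEigenvalue_ne_zero g)

theorem IsMetaplectic.inner_vacuum_apply (hμ : IsMetaplectic d μ)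
    (g : Matrix.unitaryGroup (Fin d) ℂ) (f : L2Config d) :
    inner ℂ (vacuum d) (μ (unitaryToSymplectic d g) f) =
      hμ.vacuumEigenvalue g * inner ℂ (vacuum d) f := by
  have h := (μ (unitaryToSymplectic d g)).inner_map_map (vacuum d) f
  rw [hμ.apply_vacuum, inner_smul_left] at h
  rw [← h, ← mul_assoc, Complex.mul_conj', hμ.norm_vacuumEigenvalue]
  simp

/-- The squared vacuum expectation `⟪φ₀, μ(S) φ₀⟫²`, which does not depend on signs. -/
noncomputable def vacuumExpectationSq
    (μ : Matrix.symplecticGroup (Fin d) ℝ → (L2Config d ≃ₗᵢ[ℂ] L2Config d))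
    (S : Matrix.symplecticGroup (Fin d) ℝ) : ℂ :=
  (inner ℂ (vacuum d) (μ S (vacuum d))) ^ 2

/-- Unitary factors change the squared vacuum expectation by their character only, since the vacuum
is an eigenvector of their metaplectic operators. -/
theorem IsMetaplectic.vacuumExpectationSq_left (hμ : IsMetaplectic d μ)
    (g : Matrix.unitaryGroup (Fin d) ℂ) (S : Matrix.symplecticGroup (Fin d) ℝ) :
    vacuumExpectationSq μ (unitaryToSymplectic d g * S) =
      hμ.vacuumCharacter g * vacuumExpectationSq μ S := by
  simp only [vacuumExpectationSq, hμ.vacuumCharacter_apply]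
  rcases hμ.mul_up_to_sign (unitaryToSymplectic d g) S with hs | hs <;>
    rw [hs] <;> simp only [inner_neg_right, neg_sq, hμ.inner_vacuum_apply, mul_pow]

theorem IsMetaplectic.vacuumExpectationSq_right (hμ : IsMetaplectic d μ)
    (g : Matrix.unitaryGroup (Fin d) ℂ) (S : Matrix.symplecticGroup (Fin d) ℝ) :
    vacuumExpectationSq μ (S * unitaryToSymplectic d g) =
      hμ.vacuumCharacter g * vacuumExpectationSq μ S := by
  simp only [vacuumExpectationSq, hμ.vacuumCharacter_apply]
  rcases hμ.mul_up_to_sign S (unitaryToSymplectic d g) with hs | hs <;>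
    rw [hs] <;> simp only [inner_neg_right, neg_sq, hμ.apply_vacuum, map_smul, inner_smul_right,
      mul_pow]

end

/-! ### Shears and chirps -/

/-- The symplectic shear `(p, q) ↦ (p, q + s p)`, where `s` acts coordinatewise. -/
def shear {d : ℕ} (s : Fin d → ℝ) : Matrix.symplecticGroup (Fin d) ℝ :=
  ⟨Matrix.fromBlocks 1 0 (Matrix.diagonal s) 1, by
    rw [SymplecticGroup.mem_iff, Matrix.J, Matrix.fromBlocks_transpose, Matrix.fromBlocks_multiply,
      Matrix.fromBlocks_multiply]
    simp⟩

theorem shear_add {d : ℕ} (s t : Fin d → ℝ) : shear (s + t) = shear s * shear t := by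
  refine Subtype.ext ?_
  rw [Submonoid.coe_mul]
  simp only [shear]
  rw [Matrix.fromBlocks_multiply]
  simp [Matrix.diagonal_add]

theorem shear_mulVec {d : ℕ} (s : Fin d → ℝ) (w : Fin d ⊕ Fin d → ℝ) :
    Matrix.mulVec (shear s : Matrix (Fin d ⊕ Fin d) (Fin d ⊕ Fin d) ℝ) w =
      Sum.elim (fun j => w (Sum.inl j)) fun j => w (Sum.inr j) + s j * w (Sum.inl j) := by
  simp only [shear]
  rw [Matrix.fromBlocks_mulVec]
  congr 1
  · simp; rfl
  · ext j
    simp [Matrix.mulVec_diagonal, add_comm]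

/-- The unimodular function `x ↦ e^{-πi Σ s_j x_j²}`. -/
noncomputable def chirpPhase {d : ℕ} (s : Fin d → ℝ) (x : EuclideanSpace ℝ (Fin d)) : ℂ :=
  Complex.exp (((-(Real.pi * ∑ j, s j * x j ^ 2) : ℝ) : ℂ) * Complex.I)

theorem norm_chirpPhase {d : ℕ} (s : Fin d → ℝ) (x : EuclideanSpace ℝ (Fin d)) :
    ‖chirpPhase s x‖ = 1 := Complex.norm_exp_ofReal_mul_I _

theorem continuous_chirpPhase {d : ℕ} (s : Fin d → ℝ) : Continuous (chirpPhase s) := by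
  unfold chirpPhase
  fun_prop

theorem memLp_chirpPhase_mul {d : ℕ} (s : Fin d → ℝ) (f : L2Config d) :
    MemLp (fun x => chirpPhase s x * f x) 2 volume :=
  (Lp.memLp f).congr_norm
    ((continuous_chirpPhase s).aestronglyMeasurable.mul (Lp.memLp f).aestronglyMeasurable)
    (ae_of_all _ fun x => by rw [norm_mul, norm_chirpPhase, one_mul])

/-- Multiplication by `e^{-πi Σ s_j x_j²}` on `L²(ℝ^d)`. -/
noncomputable def chirp {d : ℕ} (s : Fin d → ℝ) : L2Config d →ₗᵢ[ℂ] L2Config d where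
  toFun f := (memLp_chirpPhase_mul s f).toLp _
  map_add' f g := by
    rw [← MemLp.toLp_add, MemLp.toLp_eq_toLp_iff]
    filter_upwards [Lp.coeFn_add f g] with x hx
    simp only [hx, Pi.add_apply, mul_add]
  map_smul' c f := by
    rw [RingHom.id_apply, ← MemLp.toLp_const_smul, MemLp.toLp_eq_toLp_iff]
    filter_upwards [Lp.coeFn_smul c f] with x hx
    simp only [hx, Pi.smul_apply, smul_eq_mul, mul_left_comm]
  norm_map' f := by
    change ‖(memLp_chirpPhase_mul s f).toLp _‖ = ‖f‖
    rw [Lp.norm_toLp, Lp.norm_def]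
    congr 1
    refine eLpNorm_congr_norm_ae (ae_of_all _ fun x => ?_)
    rw [norm_mul, norm_chirpPhase, one_mul]

theorem chirp_coeFn {d : ℕ} (s : Fin d → ℝ) (f : L2Config d) :
    chirp s f =ᵐ[volume] fun x => chirpPhase s x * f x :=
  MemLp.coeFn_toLp (memLp_chirpPhase_mul s f)

theorem chirp_add {d : ℕ} (s t : Fin d → ℝ) (f : L2Config d) :
    chirp (s + t) f = chirp s (chirp t f) := by
  refine Lp.ext ?_
  filter_upwards [chirp_coeFn (s + t) f, chirp_coeFn s (chirp t f), chirp_coeFn t f]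
    with x h1 h2 h3
  rw [h1, h2, h3, ← mul_assoc]
  congr 1
  simp only [chirpPhase]
  rw [← Complex.exp_add]
  congr 1
  simp only [Pi.add_apply, add_mul, Finset.sum_add_distrib]
  push_cast
  ring

/-- The chirp implements the shear on the Heisenberg operators. -/
theorem chirp_heisenberg {d : ℕ} (s : Fin d → ℝ) (w : Fin d ⊕ Fin d → ℝ) (f : L2Config d) :
    chirp s (heisenberg d w f) =
      heisenberg d (Matrix.mulVec (shear s : Matrix (Fin d ⊕ Fin d) (Fin d ⊕ Fin d) ℝ) w)
        (chirp s f) := by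
  refine Lp.ext ?_
  rw [shear_mulVec]
  filter_upwards [chirp_coeFn s (heisenberg d w f), heisenberg_coeFn d w f,
    heisenberg_coeFn d (Sum.elim (fun j => w (Sum.inl j))
      fun j => w (Sum.inr j) + s j * w (Sum.inl j)) (chirp s f),
    ae_comp_add_right (chirp_coeFn s f) (WithLp.toLp 2 fun j => w (Sum.inl j))] with x h1 h2 h3 h4
  rw [h1, h2, h3]
  simp only [Sum.elim_inl, Sum.elim_inr]
  rw [h4, ← mul_assoc, ← mul_assoc]
  congr 1
  simp only [chirpPhase]
  rw [← Complex.exp_add, ← Complex.exp_add, ← add_mul, ← add_mul]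
  congr 2
  norm_cast
  simp only [Finset.mul_sum, ← Finset.sum_neg_distrib, ← Finset.sum_add_distrib, PiLp.add_apply]
  refine Finset.sum_congr rfl fun j _ => ?_
  ring

theorem bargmannKernel_zero (d : ℕ) (x : EuclideanSpace ℝ (Fin d)) :
    bargmannKernel d 0 x =
      ((2 ^ ((d : ℝ) / 4) * Real.exp (-(Real.pi * ∑ j, x j ^ 2)) : ℝ) : ℂ) := by
  simp [bargmannKernel]

theorem inner_vacuum_chirp_sq {d : ℕ} (s : Fin d → ℝ) :
    (inner ℂ (vacuum d) (chirp s (vacuum d)) : ℂ) ^ 2 =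
      ∏ j, (1 + (s j / 2 : ℝ) * Complex.I)⁻¹ := by
  have hpi : (Real.pi : ℂ) ≠ 0 := by exact_mod_cast Real.pi_ne_zero
  have h1 : (inner ℂ (vacuum d) (chirp s (vacuum d)) : ℂ) =
      ((2 ^ ((d : ℝ) / 4) : ℝ) : ℂ) ^ 2 *
        ∏ j, (Real.pi / (2 * Real.pi + Real.pi * s j * Complex.I) : ℂ) ^ (1 / 2 : ℂ) := by
    have h2 := integral_euclidean_cexp_neg_sum_mul_sq_add d
      (b := fun j => 2 * Real.pi + Real.pi * s j * Complex.I) (fun j => by simp [Real.pi_pos]) 0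
    simp only [Pi.zero_apply, zero_mul, Finset.sum_const_zero, add_zero, ne_eq,
      OfNat.ofNat_ne_zero, not_false_eq_true, zero_pow, zero_div, Complex.exp_zero, mul_one] at h2
    rw [← h2, ← integral_const_mul, L2.inner_def]
    refine integral_congr_ae ?_
    filter_upwards [vacuum_coeFn d, chirp_coeFn s (vacuum d)] with x hx hc
    rw [RCLike.inner_apply, hc, hx]
    rw [bargmannKernel_zero, Complex.conj_ofReal, chirpPhase, Complex.ofReal_mul,
      Complex.ofReal_exp, mul_assoc, mul_mul_mul_comm, ← Complex.exp_add, mul_left_comm,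
      ← Complex.exp_add, pow_two]
    congr 2
    push_cast
    simp only [Finset.mul_sum, Finset.sum_mul, ← Finset.sum_neg_distrib, ← Finset.sum_add_distrib]
    refine Finset.sum_congr rfl fun j _ => ?_
    ring
  have h3 : ((2 ^ ((d : ℝ) / 4) : ℝ) : ℂ) ^ 4 = ∏ _j : Fin d, (2 : ℂ) := by
    rw [Finset.prod_const, Finset.card_univ, Fintype.card_fin]
    norm_cast
    rw [← Real.rpow_mul_natCast (by norm_num), show (d : ℝ) / 4 * (4 : ℕ) = d by push_cast; ring,
      Real.rpow_natCast]
    push_cast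
    rfl
  rw [h1, mul_pow, ← pow_mul, h3, ← Finset.prod_pow, ← Finset.prod_mul_distrib]
  refine Finset.prod_congr rfl fun j _ => ?_
  have h4 : (1 + (s j / 2 : ℝ) * Complex.I : ℂ) ≠ 0 := fun h => by
    simpa using congrArg Complex.re h
  have h5 : (2 * Real.pi + Real.pi * s j * Complex.I : ℂ) =
      2 * Real.pi * (1 + (s j / 2 : ℝ) * Complex.I) := by push_cast; ring
  rw [← Complex.cpow_nat_mul, h5]
  push_cast at h4 ⊢
  norm_num
  field_simp

section

variable {d : ℕ} {μ : Matrix.symplecticGroup (Fin d) ℝ → (L2Config d ≃ₗᵢ[ℂ] L2Config d)}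

theorem IsMetaplectic.exists_shear_eq_smul_chirp (hμ : IsMetaplectic d μ) (s : Fin d → ℝ) :
    ∃ c : ℂ, ∀ f, μ (shear s) f = c • chirp s f :=
  exists_smul_of_intertwines d _ (symplectic_mulVec_surjective d (shear s))
    (μ (shear s)).toLinearIsometry (chirp s) (fun w f => hμ.intertwines (shear s) w f)
    fun w f => chirp_heisenberg s w f

/-- The square of the scalar by which `μ(shear s)` differs from the chirp. -/
noncomputable def IsMetaplectic.shearFactor (hμ : IsMetaplectic d μ) (s : Fin d → ℝ) : ℂ :=
  (hμ.exists_shear_eq_smul_chirp s).choose ^ 2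

theorem IsMetaplectic.shearFactor_ne_zero (hμ : IsMetaplectic d μ) (s : Fin d → ℝ) :
    hμ.shearFactor s ≠ 0 := by
  refine pow_ne_zero 2 fun h0 => ?_
  have h := (hμ.exists_shear_eq_smul_chirp s).choose_spec (vacuum d)
  rw [h0, zero_smul] at h
  exact vacuum_ne_zero d ((map_eq_zero_iff _ (μ (shear s)).injective).1 h)

/-- The sign ambiguity disappears in the square, so that `shearFactor` is an additive character. -/
theorem IsMetaplectic.shearFactor_add (hμ : IsMetaplectic d μ) (s t : Fin d → ℝ) :
    hμ.shearFactor (s + t) = hμ.shearFactor s * hμ.shearFactor t := by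
  have hst := (hμ.exists_shear_eq_smul_chirp (s + t)).choose_spec (vacuum d)
  have hs := (hμ.exists_shear_eq_smul_chirp s).choose_spec
  have ht := (hμ.exists_shear_eq_smul_chirp t).choose_spec (vacuum d)
  simp only [IsMetaplectic.shearFactor]
  set a := (hμ.exists_shear_eq_smul_chirp (s + t)).choose
  set b := (hμ.exists_shear_eq_smul_chirp s).choose
  set c := (hμ.exists_shear_eq_smul_chirp t).choose
  have h0 : chirp (s + t) (vacuum d) ≠ 0 :=
    (map_ne_zero_iff _ (chirp (s + t)).injective).2 (vacuum_ne_zero d)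
  have h1 : μ (shear s) (μ (shear t) (vacuum d)) = (b * c) • chirp (s + t) (vacuum d) := by
    rw [ht, map_smul, hs, smul_smul, mul_comm, chirp_add]
  rw [shear_add] at hst
  rcases hμ.mul_up_to_sign (shear s) (shear t) with h | h <;> rw [h, h1] at hst
  · rw [← smul_left_injective ℂ h0 hst, mul_pow]
  · rw [← neg_smul] at hst
    rw [← smul_left_injective ℂ h0 hst, neg_sq, mul_pow]

theorem IsMetaplectic.vacuumExpectationSq_shear (hμ : IsMetaplectic d μ) (s : Fin d → ℝ) :
    vacuumExpectationSq μ (shear s) =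
      hμ.shearFactor s * ∏ j, (1 + (s j / 2 : ℝ) * Complex.I)⁻¹ := by
  rw [vacuumExpectationSq, (hμ.exists_shear_eq_smul_chirp s).choose_spec, inner_smul_right, mul_pow,
    inner_vacuum_chirp_sq, IsMetaplectic.shearFactor]

end

/-! ### Diagonal unitary matrices -/

/-- The diagonal unitary matrix with the given entries on the unit circle. -/
def diagUnitary (d : ℕ) : (Fin d → Circle) →* Matrix.unitaryGroup (Fin d) ℂ where
  toFun u := ⟨Matrix.diagonal fun j => (u j : ℂ), by
    rw [Matrix.mem_unitaryGroup_iff, Matrix.star_eq_conjTranspose, Matrix.diagonal_conjTranspose,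
      Matrix.diagonal_mul_diagonal, ← Matrix.diagonal_one]
    congr 1
    ext j
    simp [Complex.mul_conj', Circle.norm_coe]⟩
  map_one' := Subtype.ext (by simp)
  map_mul' u v := Subtype.ext (by simp)

theorem coe_diagUnitary (d : ℕ) (u : Fin d → Circle) :
    (diagUnitary d u : Matrix (Fin d) (Fin d) ℂ) = Matrix.diagonal fun j => (u j : ℂ) := rfl

/-- The point `(1 - i a) / √(1 + a²)` of the unit circle. -/
noncomputable def halfCayley (a : ℝ) : Circle :=
  ⟨⟨1 / √(1 + a ^ 2), -a / √(1 + a ^ 2)⟩, by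
    rw [Submonoid.unitSphere, Submonoid.mem_mk, Subsemigroup.mem_mk, mem_sphere_zero_iff_norm,
      ← sq_eq_sq₀ (norm_nonneg _) zero_le_one, Complex.sq_norm,
      Complex.normSq_mk]
    have h := Real.sq_sqrt (show 0 ≤ 1 + a ^ 2 by positivity)
    have h' : √(1 + a ^ 2) ≠ 0 := (Real.sqrt_pos.2 (by positivity)).ne'
    field_simp
    linarith⟩

/-- The Cayley transform `(1 - i a) / (1 + i a)`, written as the square of a point of the circle. -/
noncomputable def cayley (a : ℝ) : Circle := halfCayley a ^ 2

theorem one_add_mul_I_ne_zero (a : ℝ) : (1 + a * Complex.I : ℂ) ≠ 0 := fun h => by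
  simpa using congrArg Complex.re h

theorem coe_cayley (a : ℝ) :
    (cayley a : ℂ) = (1 + (-a : ℝ) * Complex.I) * (1 + a * Complex.I)⁻¹ := by
  have h1 : (halfCayley a : ℂ) = (1 - a * Complex.I) / (√(1 + a ^ 2) : ℝ) := by
    have : (halfCayley a : ℂ) = ⟨1 / √(1 + a ^ 2), -a / √(1 + a ^ 2)⟩ := rfl
    rw [this]
    apply Complex.ext <;> simp [Complex.div_ofReal_re, Complex.div_ofReal_im]
  have h2 : ((√(1 + a ^ 2) : ℝ) : ℂ) ^ 2 = (1 - a * Complex.I) * (1 + a * Complex.I) := by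
    rw [← Complex.ofReal_pow, Real.sq_sqrt (by positivity)]
    push_cast
    linear_combination (a : ℂ) ^ 2 * Complex.I_sq
  have h3 := one_add_mul_I_ne_zero a
  have h4 := one_add_mul_I_ne_zero (-a)
  push_cast at h4 ⊢
  rw [cayley, Circle.coe_pow, h1, div_pow, h2]
  rw [neg_mul, ← sub_eq_add_neg] at h4 ⊢
  field_simp

/-- The addition theorem of the tangent, for arguments with `a b = -1`. -/
theorem cayley_mul_cayley {a b : ℝ} (hab : a * b = -1) :
    cayley a * cayley b = cayley ((a + b) / 2) := by
  refine Circle.ext ?_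
  rw [Circle.coe_mul, coe_cayley, coe_cayley, coe_cayley]
  have h1 := one_add_mul_I_ne_zero a
  have h2 := one_add_mul_I_ne_zero b
  have h3 := one_add_mul_I_ne_zero ((a + b) / 2)
  have hab' : (a * b : ℂ) = -1 := by exact_mod_cast hab
  push_cast at h3 ⊢
  rw [← div_eq_mul_inv, ← div_eq_mul_inv, ← div_eq_mul_inv, div_mul_div_comm,
    div_eq_div_iff (mul_ne_zero h1 h2) h3]
  linear_combination ((a + b : ℂ) * Complex.I * (a * b)) * Complex.I_sq -
    ((a + b : ℂ) * Complex.I) * hab'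

/-- In each coordinate, `k · shear(2a) · k = J · shear(-2a) · J⁻¹` in `SL₂(ℝ)`, where `k` is the
rotation that corresponds to `(1 - i a) / √(1 + a²)` and `J` the one that corresponds to `i`. -/
theorem rotation_mul_shear_mul_rotation (d : ℕ) (a : Fin d → ℝ) :
    unitaryToSymplectic d (diagUnitary d fun j => halfCayley (a j)) * shear (2 • a) *
        unitaryToSymplectic d
          (diagUnitary d ((fun j => halfCayley (a j)) * fun _ => Circle.exp (Real.pi / 2))) =
      unitaryToSymplectic d (diagUnitary d fun _ => Circle.exp (Real.pi / 2)) * shear (-(2 • a)) := by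
  have hI : (Circle.exp (Real.pi / 2) : ℂ) = Complex.I := by
    rw [Circle.coe_exp]; push_cast; exact Complex.exp_pi_div_two_mul_I
  have hre : ∀ a : ℝ, (halfCayley a : ℂ).re = 1 / √(1 + a ^ 2) := fun _ => rfl
  have him : ∀ a : ℝ, (halfCayley a : ℂ).im = -a / √(1 + a ^ 2) := fun _ => rfl
  have hz : ∀ f : ℂ → ℝ, f 0 = 0 → ∀ u : Fin d → ℂ, (Matrix.diagonal u).map f =
      Matrix.diagonal fun j => f (u j) := fun f hf u => Matrix.diagonal_map hf
  refine Subtype.ext ?_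
  simp only [Submonoid.coe_mul, unitaryToSymplectic, shear, coe_diagUnitary]
  simp only [hz _ Complex.zero_re, hz _ Complex.zero_im, Pi.mul_apply, Circle.coe_mul, hI,
    Matrix.diagonal_neg, ← Matrix.diagonal_one, ← Matrix.diagonal_zero, Matrix.fromBlocks_multiply,
    Matrix.diagonal_mul_diagonal, Matrix.diagonal_add]
  have hs := fun j => Real.sq_sqrt (show 0 ≤ 1 + a j ^ 2 by positivity)
  have hs' : ∀ j, √(1 + a j ^ 2) ≠ 0 := fun j => (Real.sqrt_pos.2 (by positivity)).ne'
  congr 1 <;> congr 1 <;> ext j <;> simp [hre, him] <;> have h1 := hs j <;> have h2 := hs' j <;>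
    field_simp <;> (try rw [h1]) <;> ring

/-! ### The vacuum character on diagonal matrices of Cayley transforms -/

theorem diagUnitary_det (d : ℕ) (u : Fin d → Circle) :
    Matrix.det (diagUnitary d u : Matrix (Fin d) (Fin d) ℂ) = ∏ j, (u j : ℂ) := by
  rw [coe_diagUnitary, Matrix.det_diagonal]

section

variable {d : ℕ} {μ : Matrix.symplecticGroup (Fin d) ℝ → (L2Config d ≃ₗᵢ[ℂ] L2Config d)}

theorem IsMetaplectic.shearFactor_zero (hμ : IsMetaplectic d μ) : hμ.shearFactor 0 = 1 := by
  have h := hμ.shearFactor_add 0 0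
  rw [add_zero] at h
  exact (mul_eq_left₀ (hμ.shearFactor_ne_zero 0)).1 h.symm

/-- Comparison of the vacuum expectations of `shear(s)` and `shear(-s)`: the Gaussian integrals give
the Cayley transform, and what is left is an additive character of `ℝ^d`. -/
theorem IsMetaplectic.vacuumCharacter_cayley_mul_prod (hμ : IsMetaplectic d μ) (a : Fin d → ℝ) :
    hμ.vacuumCharacter (diagUnitary d fun j => cayley (a j)) * ∏ j, (cayley (a j) : ℂ) =
      hμ.shearFactor (-(2 • a)) ^ 2 := by
  set k : Fin d → Circle := fun j => halfCayley (a j) with hk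
  set i : Fin d → Circle := fun _ => Circle.exp (Real.pi / 2) with hi
  have h1 := congrArg (vacuumExpectationSq μ) (rotation_mul_shear_mul_rotation d a)
  rw [hμ.vacuumExpectationSq_right, hμ.vacuumExpectationSq_left, hμ.vacuumExpectationSq_left,
    ← hk, ← hi, map_mul, map_mul, mul_comm (hμ.vacuumCharacter (diagUnitary d k)), mul_assoc] at h1
  have h2 : hμ.vacuumCharacter (diagUnitary d i) ≠ 0 := hμ.vacuumCharacter_ne_zero _
  have h3 : hμ.vacuumCharacter (diagUnitary d k) * (hμ.vacuumCharacter (diagUnitary d k) *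
      vacuumExpectationSq μ (shear (2 • a))) = vacuumExpectationSq μ (shear (-(2 • a))) :=
    mul_left_cancel₀ h2 h1
  have h4 : hμ.vacuumCharacter (diagUnitary d fun j => cayley (a j)) =
      hμ.vacuumCharacter (diagUnitary d k) * hμ.vacuumCharacter (diagUnitary d k) := by
    rw [← map_mul, ← map_mul]
    congr 2
    ext j
    simp [hk, cayley, sq]
  have hs : hμ.shearFactor (2 • a) * hμ.shearFactor (-(2 • a)) = 1 := by
    rw [← hμ.shearFactor_add, add_neg_cancel, hμ.shearFactor_zero]
  rw [← mul_assoc, ← h4, hμ.vacuumExpectationSq_shear, hμ.vacuumExpectationSq_shear] at h3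
  have e1 : ∀ j, (2 • a) j / 2 = a j := fun j => by simp
  have e2 : ∀ j, (-(2 • a)) j / 2 = -a j := fun j => by simp; ring
  simp only [e1, e2, Finset.prod_inv_distrib] at h3
  simp only [coe_cayley, Finset.prod_mul_distrib, Finset.prod_inv_distrib]
  have hne : ∏ j, (1 + (-a j : ℝ) * Complex.I : ℂ) ≠ 0 :=
    Finset.prod_ne_zero_iff.2 fun j _ => one_add_mul_I_ne_zero _
  have h5 := congrArg (fun x => x * hμ.shearFactor (-(2 • a)) *
    ∏ j, (1 + (-a j : ℝ) * Complex.I : ℂ)) h3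
  beta_reduce at h5
  have h6 := mul_inv_cancel₀ hne
  linear_combination h5 - hμ.vacuumCharacter (diagUnitary d fun j => cayley (a j)) *
    (∏ j, (1 + (a j : ℝ) * Complex.I : ℂ))⁻¹ * (∏ j, (1 + (-a j : ℝ) * Complex.I : ℂ)) * hs +
    hμ.shearFactor (-(2 • a)) ^ 2 * h6

/-- The multiplicativity of the left side of `vacuumCharacter_cayley_mul_prod` in the Cayley
transform is incompatible with the additivity of the right side, unless both are trivial. -/
theorem IsMetaplectic.shearFactor_sq (hμ : IsMetaplectic d μ) (u : Fin d → ℝ) :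
    hμ.shearFactor u ^ 2 = 1 := by
  -- `a` and `b` solve `a + b = -u` and `a b = -1`
  let a : Fin d → ℝ := fun j => (-u j + √(u j ^ 2 + 4)) / 2
  let b : Fin d → ℝ := fun j => (-u j - √(u j ^ 2 + 4)) / 2
  have hab : ∀ j, a j * b j = -1 := fun j => by
    have := Real.sq_sqrt (show 0 ≤ u j ^ 2 + 4 by positivity)
    simp only [a, b]
    linarith
  have hc : ∀ j, cayley (a j) * cayley (b j) = cayley (((1 / 2 : ℝ) • (a + b)) j) := fun j => by
    rw [cayley_mul_cayley (hab j)]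
    congr 1
    simp
    ring
  have hu : -(2 • ((1 / 2 : ℝ) • (a + b))) = u := by
    ext j; simp [a, b]; ring
  have hu2 : -(2 • a) + -(2 • b) = u + u := by
    ext j; simp [a, b]; ring
  have h1 := hμ.vacuumCharacter_cayley_mul_prod a
  have h2 := hμ.vacuumCharacter_cayley_mul_prod b
  have h3 := hμ.vacuumCharacter_cayley_mul_prod ((1 / 2 : ℝ) • (a + b))
  rw [hu] at h3
  simp only [← hc, Circle.coe_mul, Finset.prod_mul_distrib] at h3
  have h4 : (diagUnitary d fun j => cayley (a j) * cayley (b j)) =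
      (diagUnitary d fun j => cayley (a j)) * diagUnitary d fun j => cayley (b j) :=
    map_mul (diagUnitary d) (fun j => cayley (a j)) fun j => cayley (b j)
  rw [h4, map_mul, mul_mul_mul_comm, h1, h2, ← mul_pow, ← hμ.shearFactor_add, hu2,
    hμ.shearFactor_add, mul_pow] at h3
  exact (mul_eq_left₀ (pow_ne_zero 2 (hμ.shearFactor_ne_zero u))).1 h3

theorem IsMetaplectic.vacuumCharacter_cayley (hμ : IsMetaplectic d μ) (a : Fin d → ℝ) :
    hμ.vacuumCharacter (diagUnitary d fun j => cayley (a j)) =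
      (Matrix.det (diagUnitary d fun j => cayley (a j) : Matrix (Fin d) (Fin d) ℂ))⁻¹ := by
  have h := hμ.vacuumCharacter_cayley_mul_prod a
  rw [hμ.shearFactor_sq] at h
  rw [diagUnitary_det]
  exact eq_inv_of_mul_eq_one_left h

end

/-! ### Reduction of unitary matrices to Cayley transforms -/

/-- A unitary matrix `g` without eigenvalue `-1` is diagonalized by a unitary matrix: the Hermitian
matrix `i (1 - g) (1 + g)⁻¹` is. -/
theorem exists_eq_conj_diagUnitary_cayley {d : ℕ} (g : Matrix.unitaryGroup (Fin d) ℂ)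
    (hg : IsUnit (1 + (g : Matrix (Fin d) (Fin d) ℂ))) :
    ∃ (h : Matrix.unitaryGroup (Fin d) ℂ) (a : Fin d → ℝ),
      g = h * (diagUnitary d fun j => cayley (a j)) * h⁻¹ := by
  set G : Matrix (Fin d) (Fin d) ℂ := g.1 with hG
  have hdet : IsUnit (1 + G).det := (Matrix.isUnit_iff_isUnit_det _).1 hg
  have hGG : G.conjTranspose * G = 1 := (Matrix.mem_unitaryGroup_iff').1 g.2
  set H : Matrix (Fin d) (Fin d) ℂ := (Complex.I • (1 - G)) * (1 + G)⁻¹ with hH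
  have hHM : H * (1 + G) = Complex.I • (1 - G) := by
    rw [hH, mul_assoc, Matrix.nonsing_inv_mul _ hdet, mul_one]
  have hherm : H.IsHermitian := by
    have h1 : (1 + G).conjTranspose * (H.conjTranspose * (1 + G)) =
        (1 + G).conjTranspose * (H * (1 + G)) := by
      rw [← mul_assoc, ← Matrix.conjTranspose_mul, hHM]
      simp only [Matrix.conjTranspose_smul, Matrix.conjTranspose_sub, Matrix.conjTranspose_add,
        Matrix.conjTranspose_one, RCLike.star_def, Complex.conj_I, Matrix.smul_mul, Matrix.mul_smul]
      rw [neg_smul, ← smul_neg]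
      congr 1
      simp only [add_mul, sub_mul, mul_add, mul_sub, one_mul, mul_one, hGG]
      abel
    have hM : IsUnit (1 + G).conjTranspose := by
      rw [← Matrix.star_eq_conjTranspose]; exact hg.star
    have h2 := hM.mul_left_cancel h1
    exact hg.mul_right_cancel h2
  set V := hherm.eigenvectorUnitary with hV
  have hVV : star (V : Matrix (Fin d) (Fin d) ℂ) * V = 1 := (Matrix.mem_unitaryGroup_iff').1 V.2
  have hVV' : (V : Matrix (Fin d) (Fin d) ℂ) * star (V : Matrix (Fin d) (Fin d) ℂ) = 1 :=
    (Matrix.mem_unitaryGroup_iff).1 V.2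
  set D : Matrix (Fin d) (Fin d) ℂ := Matrix.diagonal (RCLike.ofReal ∘ hherm.eigenvalues) with hD
  have hspec : H = V * D * star (V : Matrix (Fin d) (Fin d) ℂ) := by
    have := hherm.spectral_theorem
    rwa [Unitary.conjStarAlgAut_apply] at this
  set G' : Matrix (Fin d) (Fin d) ℂ := star (V : Matrix (Fin d) (Fin d) ℂ) * G * V with hG'
  have hDG : D * (1 + G') = Complex.I • (1 - G') := by
    have h1 : star (V : Matrix (Fin d) (Fin d) ℂ) * (H * (1 + G)) * V =
        star (V : Matrix (Fin d) (Fin d) ℂ) * (Complex.I • (1 - G)) * V := by rw [hHM]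
    have h2 : star (V : Matrix (Fin d) (Fin d) ℂ) * (H * (1 + G)) * V = D * (1 + G') := by
      rw [hspec, hG', mul_add, ← hVV]
      simp only [← mul_assoc, hVV, one_mul, mul_add, add_mul, mul_one]
      rw [mul_assoc D, hVV, mul_one]
    rw [← h2, h1, hG', Matrix.mul_smul, Matrix.smul_mul, mul_sub, sub_mul, mul_one, hVV]
  have hdiag : G' = Matrix.diagonal fun j => (cayley (-hherm.eigenvalues j) : ℂ) := by
    ext i j
    have h1 := congrFun (congrFun hDG i) j
    rw [hD, Matrix.diagonal_mul, Matrix.add_apply, Matrix.smul_apply, Matrix.sub_apply,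
      smul_eq_mul, Function.comp_apply] at h1
    set t := hherm.eigenvalues i with ht
    have h2 := one_add_mul_I_ne_zero (-t)
    -- entrywise, `t (δ + G') = i (δ - G')`; the factor `t + i` is invertible because `t` is real
    have h3 : (t : ℂ) * ((1 : Matrix (Fin d) (Fin d) ℂ) i j + G' i j) =
      Complex.I * ((1 : Matrix (Fin d) (Fin d) ℂ) i j - G' i j) := h1
    have h4 : G' i j * (1 + (-t : ℝ) * Complex.I) =
        (1 : Matrix (Fin d) (Fin d) ℂ) i j * (1 + t * Complex.I) := by
      push_cast
      linear_combination (-Complex.I) * h3 + (G' i j - (1 : Matrix (Fin d) (Fin d) ℂ) i j) *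
        Complex.I_sq
    have h5 : G' i j = (1 : Matrix (Fin d) (Fin d) ℂ) i j * (cayley (-t) : ℂ) := by
      rw [coe_cayley, ← mul_assoc, eq_mul_inv_iff_mul_eq₀ h2, h4, neg_neg]
    rw [h5, Matrix.one_apply, Matrix.diagonal_apply]
    split_ifs <;> simp [ht]
  refine ⟨V, fun j => -hherm.eigenvalues j, Subtype.ext ?_⟩
  rw [Submonoid.coe_mul, Submonoid.coe_mul, coe_diagUnitary, ← hdiag, hG']
  change G = _ * _ * star (V : Matrix (Fin d) (Fin d) ℂ)
  rw [← mul_assoc, ← mul_assoc, hVV', one_mul, mul_assoc, hVV', mul_one]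

theorem cayley_injective : Function.Injective fun t : ℝ => (cayley t : ℂ) := by
  intro s t h
  have h1 := one_add_mul_I_ne_zero s
  have h2 := one_add_mul_I_ne_zero t
  simp only [coe_cayley] at h
  rw [← div_eq_mul_inv, ← div_eq_mul_inv, div_eq_div_iff h1 h2] at h
  have h3 := congrArg Complex.im h
  simp at h3
  linarith

/-- Multiplication by a suitable scalar moves the spectrum of a unitary matrix away from `-1`. -/
theorem exists_isUnit_one_add_cayley_inv_mul {d : ℕ} (g : Matrix.unitaryGroup (Fin d) ℂ) :
    ∃ t : ℝ, IsUnit (1 + (((diagUnitary d fun _ => cayley t)⁻¹ * g :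
      Matrix.unitaryGroup (Fin d) ℂ) : Matrix (Fin d) (Fin d) ℂ)) := by
  set G : Matrix (Fin d) (Fin d) ℂ := g.1 with hG
  have hinf : (Set.range fun t : ℝ => -(cayley t : ℂ)).Infinite :=
    Set.infinite_range_of_injective fun s t h => cayley_injective (neg_injective h)
  -- a point `-λ(t)` of the circle that is not an eigenvalue
  obtain ⟨_, ⟨t, rfl⟩, ht⟩ := hinf.exists_notMem_finset G.charpoly.roots.toFinset
  refine ⟨t, ?_⟩
  rw [Multiset.mem_toFinset, Polynomial.mem_roots (Matrix.charpoly_monic G).ne_zero,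
    Polynomial.IsRoot.def, Matrix.eval_charpoly] at ht
  have h1 : IsUnit (Matrix.scalar (Fin d) (-(cayley t : ℂ)) - G) :=
    (Matrix.isUnit_iff_isUnit_det _).2 (isUnit_iff_ne_zero.2 ht)
  have hc : (cayley t : ℂ) ≠ 0 := Circle.coe_ne_zero _
  have h2 : (1 : Matrix (Fin d) (Fin d) ℂ) + (((diagUnitary d fun _ => cayley t)⁻¹ * g :
      Matrix.unitaryGroup (Fin d) ℂ) : Matrix (Fin d) (Fin d) ℂ) =
      Matrix.scalar (Fin d) (-(cayley t : ℂ)⁻¹) * (Matrix.scalar (Fin d) (-(cayley t : ℂ)) - G) := by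
    rw [← map_inv, Submonoid.coe_mul, coe_diagUnitary, mul_sub, ← map_mul, ← hG]
    ext i j
    simp [hc, Matrix.diagonal_mul]
  rw [h2]
  refine IsUnit.mul ?_ h1
  exact (isUnit_iff_ne_zero.2 (neg_ne_zero.2 (inv_ne_zero hc))).map (Matrix.scalar (Fin d))

theorem IsMetaplectic.vacuumCharacter_eq_inv_det {d : ℕ}
    {μ : Matrix.symplecticGroup (Fin d) ℝ → (L2Config d ≃ₗᵢ[ℂ] L2Config d)}
    (hμ : IsMetaplectic d μ) (g : Matrix.unitaryGroup (Fin d) ℂ) :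
    hμ.vacuumCharacter g = (Matrix.det (g : Matrix (Fin d) (Fin d) ℂ))⁻¹ := by
  have hunit : ∀ g : Matrix.unitaryGroup (Fin d) ℂ,
      IsUnit (1 + (g : Matrix (Fin d) (Fin d) ℂ)) →
      hμ.vacuumCharacter g = (Matrix.det (g : Matrix (Fin d) (Fin d) ℂ))⁻¹ := by
    intro g hg
    obtain ⟨h, a, rfl⟩ := exists_eq_conj_diagUnitary_cayley g hg
    have e1 : hμ.vacuumCharacter h * hμ.vacuumCharacter h⁻¹ = 1 := by
      rw [← map_mul, mul_inv_cancel, map_one]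
    have e2 : Matrix.det (h : Matrix (Fin d) (Fin d) ℂ) *
        Matrix.det ((h⁻¹ : Matrix.unitaryGroup (Fin d) ℂ) : Matrix (Fin d) (Fin d) ℂ) = 1 := by
      rw [← Matrix.det_mul, ← Submonoid.coe_mul, mul_inv_cancel, Submonoid.coe_one, Matrix.det_one]
    rw [map_mul, map_mul, mul_right_comm, e1, one_mul, hμ.vacuumCharacter_cayley, Submonoid.coe_mul,
      Submonoid.coe_mul, Matrix.det_mul, Matrix.det_mul, mul_right_comm, e2, one_mul]
  obtain ⟨t, ht⟩ := exists_isUnit_one_add_cayley_inv_mul g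
  have h : hμ.vacuumCharacter ((diagUnitary d fun _ => cayley t) *
      ((diagUnitary d fun _ => cayley t)⁻¹ * g)) = (Matrix.det (((diagUnitary d fun _ => cayley t) *
        ((diagUnitary d fun _ => cayley t)⁻¹ * g) : Matrix.unitaryGroup (Fin d) ℂ) :
          Matrix (Fin d) (Fin d) ℂ))⁻¹ := by
    rw [map_mul, hunit _ ht, hμ.vacuumCharacter_cayley, ← mul_inv, ← Matrix.det_mul,
      ← Submonoid.coe_mul]
  rwa [mul_inv_cancel_left] at h

theorem mainTheorem6 (d : ℕ)
    (μ : Matrix.symplecticGroup (Fin d) ℝ → (L2Config d ≃ₗᵢ[ℂ] L2Config d))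
    (hμ : IsMetaplectic d μ) (g : Matrix.unitaryGroup (Fin d) ℂ) :
    ∃ c : ℂ, c ^ 2 = (Matrix.det (g : Matrix (Fin d) (Fin d) ℂ))⁻¹ ∧
      ∀ k : ℕ, ∃ hinv : ∀ F ∈ fockHomogeneous d k,
          fockOperator d (μ (unitaryToSymplectic d g)) F ∈ fockHomogeneous d k,
        ∀ v : Fin k → Fin d → ℂ,
          transportToSymmetric d k (fockOperator d (μ (unitaryToSymplectic d g))) hinv
              (SymmetricPower.tprod ℂ v) =
            c • SymmetricPower.tprod ℂ fun i =>
              Matrix.mulVec ((g : Matrix (Fin d) (Fin d) ℂ).map (starRingEnd ℂ)) (v i) :=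
  ⟨hμ.vacuumEigenvalue g, hμ.vacuumCharacter_eq_inv_det g, fun k =>
    ⟨hμ.fockOperator_mem_fockHomogeneous g k, hμ.transportToSymmetric_tprod g k _⟩⟩
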